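/- A domain is a nonempty connected open set $G\subset\mathbb C^n$; it is $n$-circled if $(e^{i\theta_1}z_1,\dots,e^{i\theta_n}z_n)\in G$ for all $z\in G$ and $\theta\in\mathbb R^n$, and fat if $G=\operatorname{int}\overline G$. Put $\log G:=\{x\in\mathbb R^n:(e^{x_1},\dots,e^{x_n})\in G\}$, and for $X\subset\mathbb R^n$ let $\mathcal E(X)$ be the largest vector subspace $F\subset\mathbb R^n$ with $X+F=X$. Let $\mathcal O(G)$ be the space of holomorphic functions on $G$. For $k\in\mathbb Z_+=\{0,1,2,\dots\}$ let $\mathcal H^{\infty,k}(G)$ be the space of all $f\in\mathcal O(G)$ with $\partial^\nu f\in L^\infty(G)$ for every multi-index $\nu\in\mathbb Z_+^n$ with $|\nu|\le k$, and let $\mathcal A^k(G)$ be the space of all $f\in\mathcal O(G)$ such that for every $|\nu|\le k$ the derivative $\partial^\nu f$ extends to a continuous function on $\overline G$. For $\mathcal F\subset\mathcal O(G)$, a domain $G$ is called an $\mathcal F$-domain of holomorphy if there are no domains $G_0,\widetilde G\subset\mathbb C^n$ with $\varnothing\ne G_0\subset G\cap\widetilde G$ and $\widetilde G\not\subset G$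 such that for each $f\in\mathcal F$ there is $\widetilde f\in\mathcal O(\widetilde G)$ with $\widetilde f=f$ on $G_0$; a domain of holomorphy is an $\mathcal O(G)$-domain of holomorphy. Proposition 7. Let $G\subset\mathbb C^n$ be an $n$-circled domain of holomorphy. Then the following conditions are equivalent: (i) up to a permutation of the coordinates, $G=D\times\mathbb C^{n-m}$, where $0\le m\le n$ and $D\subset\mathbb C^m$ is a fat $m$-circled domain of holomorphy with $\mathcal E(\log D)=\{0\}$; (ii) $G$ is an $\mathcal H^{\infty,1}(G)$-domain of holomorphy; (iii) for every $k\in\mathbb Z_+$, $G$ is an $\mathcal H^{\infty,k}(G)\cap\mathcal A^k(G)$-domain of holomorphy. -/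

import Mathlib

open Set MeasureTheory
open scoped Pointwise ENNReal

/-- A domain in `ℂⁿ`: a nonempty connected open set. -/
def IsCDomain {n : ℕ} (G : Set (Fin n → ℂ)) : Prop :=
  IsOpen G ∧ IsConnected G

/-- `G` is `n`-circled: invariant under `z ↦ (e^{iθ₁} z₁, …, e^{iθₙ} zₙ)` for all real `θ`. -/
def IsNCircled {n : ℕ} (G : Set (Fin n → ℂ)) : Prop :=
  ∀ z ∈ G, ∀ θ : Fin n → ℝ, (fun j => Complex.exp (Complex.I * (θ j : ℂ)) * z j) ∈ G

/-- `log G = {x ∈ ℝⁿ : (e^{x₁}, …, e^{xₙ}) ∈ G}`. -/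
def logSet {n : ℕ} (G : Set (Fin n → ℂ)) : Set (Fin n → ℝ) :=
  {x | (fun j => ((Real.exp (x j) : ℝ) : ℂ)) ∈ G}

/-- `𝓔(X)`: the largest vector subspace `F` of `ℝⁿ` with `X + F = X`. -/
noncomputable def linealitySpace {n : ℕ} (X : Set (Fin n → ℝ)) : Submodule ℝ (Fin n → ℝ) :=
  sSup {F : Submodule ℝ (Fin n → ℝ) | X + (F : Set (Fin n → ℝ)) = X}

/-- The supremum defining `𝓔(X)` is attained, so that `𝓔(X)` is indeed the largest such subspace. -/
theorem linealitySpace_isGreatest {n : ℕ} (X : Set (Fin n → ℝ)) :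
    IsGreatest {F : Submodule ℝ (Fin n → ℝ) | X + (F : Set (Fin n → ℝ)) = X}
      (linealitySpace X) := by
  refine ⟨?_, fun F hF => le_sSup hF⟩
  have key : ∀ v ∈ linealitySpace X, ∀ x ∈ X, x + v ∈ X := by
    intro v hv
    unfold linealitySpace at hv
    rw [sSup_eq_iSup'] at hv
    induction hv using Submodule.iSup_induction' with
    | mem F v hv =>
      intro x hx
      have hF : X + ((F : Submodule ℝ (Fin n → ℝ)) : Set (Fin n → ℝ)) = X := F.2
      exact hF ▸ Set.add_mem_add hx hv
    | zero => intro x hx; simpa using hx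
    | add v w _ _ hv hw =>
      intro x hx
      rw [← add_assoc]
      exact hw _ (hv _ hx)
  apply Set.Subset.antisymm
  · rintro _ ⟨x, hx, v, hv, rfl⟩
    exact key v hv x hx
  · intro x hx
    exact ⟨x, hx, 0, (linealitySpace X).zero_mem, add_zero x⟩

/-- `G` is fat: `G = int (closure G)`. -/
def IsFat {n : ℕ} (G : Set (Fin n → ℂ)) : Prop :=
  G = interior (closure G)

/-- `𝓞(G)`: the functions holomorphic on `G` (their values off `G` are irrelevant). -/
def holo {n : ℕ} (G : Set (Fin n → ℂ)) : Set ((Fin n → ℂ) → ℂ) :=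
  {f | DifferentiableOn ℂ f G}

/-- `G` is an `𝓕`-domain of holomorphy: it is a domain, and there are no domains `G₀`, `G₁` with
`∅ ≠ G₀ ⊆ G ∩ G₁` and `G₁ ⊄ G` such that every `f ∈ 𝓕` agrees on `G₀` with a function
holomorphic on `G₁`. -/
def IsDomainOfHolomorphyFor {n : ℕ} (𝓕 : Set ((Fin n → ℂ) → ℂ)) (G : Set (Fin n → ℂ)) : Prop :=
  IsCDomain G ∧
    ¬ ∃ G₀ G₁ : Set (Fin n → ℂ), IsCDomain G₀ ∧ IsCDomain G₁ ∧ G₀ ⊆ G ∩ G₁ ∧ ¬ G₁ ⊆ G ∧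
      ∀ f ∈ 𝓕, ∃ g ∈ holo G₁, EqOn g f G₀

/-- `G` is a domain of holomorphy, i.e. an `𝓞(G)`-domain of holomorphy. -/
def IsDomainOfHolomorphy {n : ℕ} (G : Set (Fin n → ℂ)) : Prop :=
  IsDomainOfHolomorphyFor (holo G) G

/-- The complex partial derivative `∂f/∂z_j`. -/
noncomputable def cpartial {n : ℕ} (j : Fin n) (f : (Fin n → ℂ) → ℂ) : (Fin n → ℂ) → ℂ :=
  fun z => fderiv ℂ f z (Pi.single j 1)

/-- `∂^ν f = ∂₁^{ν₁} ⋯ ∂ₙ^{νₙ} f` for a multi-index `ν`. -/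
noncomputable def multiPartial {n : ℕ} (ν : Fin n → ℕ) (f : (Fin n → ℂ) → ℂ) :
    (Fin n → ℂ) → ℂ :=
  (List.finRange n).foldr (fun j g => (cpartial j)^[ν j] g) f

/-- `L_h^{p,k}(G)`: holomorphic functions on `G` all of whose derivatives of order at most `k`
belong to `L^p(G)` with respect to Lebesgue measure. -/
def holoLp {n : ℕ} (p : ℝ≥0∞) (k : ℕ) (G : Set (Fin n → ℂ)) : Set ((Fin n → ℂ) → ℂ) :=
  {f | f ∈ holo G ∧ ∀ ν : Fin n → ℕ, ∑ j, ν j ≤ k →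
    MemLp (multiPartial ν f) p (volume.restrict G)}

/-- `𝓗^{∞,k}(G) = L_h^{∞,k}(G)`. -/
def hInfty {n : ℕ} (k : ℕ) (G : Set (Fin n → ℂ)) : Set ((Fin n → ℂ) → ℂ) :=
  holoLp ∞ k G

/-- `𝓐^k(G)`: holomorphic functions on `G` all of whose derivatives of order at most `k` extend
continuously to the closure of `G`. -/
def aSpace {n : ℕ} (k : ℕ) (G : Set (Fin n → ℂ)) : Set ((Fin n → ℂ) → ℂ) :=
  {f | f ∈ holo G ∧ ∀ ν : Fin n → ℕ, ∑ j, ν j ≤ k →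
    ∃ g : (Fin n → ℂ) → ℂ, ContinuousOn g (closure G) ∧ EqOn g (multiPartial ν f) G}

/-- Up to a permutation `σ` of the coordinates, `G = D × ℂ^{n-m}`, where `m ≤ n` and
`D ⊆ ℂ^m` is a fat `m`-circled domain of holomorphy with `𝓔(log D) = {0}`. -/
def IsFatPointedTimesAffine {n : ℕ} (G : Set (Fin n → ℂ)) : Prop :=
  ∃ (m : ℕ) (hm : m ≤ n) (σ : Equiv.Perm (Fin n)) (D : Set (Fin m → ℂ)),
    IsFat D ∧ IsNCircled D ∧ IsDomainOfHolomorphy D ∧ linealitySpace (logSet D) = ⊥ ∧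
      G = {z | (fun i : Fin m => z (σ (Fin.castLE hm i))) ∈ D}

/-!
Averaging `f ∈ 𝓞(G)` against characters of the torus gives its Laurent series `∑ a_α z^α`. On the
convex hull of `log G` this series still converges, so `log G` is convex as soon as `G` is a domain
of holomorphy for some class of functions.

If that class is `𝓗^{∞,1}(G)`, bounded functions already live on the interior of the closure, so
`G` is fat. Let `v ∈ 𝓔(log G)`. Along the line `x + tv` in `log G` the terms `a_α z^α` and
`∂_j (a_α z^α)` have modulus a constant times `e^{t⟨α, v⟩}` and `e^{t(⟨α, v⟩ - v_j)}`. Being bounded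
they force `a_α = 0`, or `⟨α, v⟩ = 0` and `α_j v_j = 0`. Hence no function of the class depends on a
coordinate `j` with `v_j ≠ 0`, and `G` is a cylinder in these coordinates.

Conversely, suppose that `log D` is convex and contains no line, and let `q` be a point outside the
closure of `D` with non-zero coordinates. Some `α ∈ ℤ^m` strictly separates `log |q|` from `log D`
while `⟨α, x⟩ ≤ C - (k + 1) ‖x‖` on `log D`. This decay makes the derivatives of `z^α` up to order
`k` extend continuously to the closure, so `1 / (q^α - z^α)` lies in `𝓗^{∞,k} ∩ 𝓐^k`, but it has a
pole at `q`.
-/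

section Holomorphic

open Filter Topology Metric

variable {E F : Type*} [NormedAddCommGroup E] [NormedSpace ℂ E]
  [NormedAddCommGroup F] [NormedSpace ℂ F] {f g : E → F} {z : E} {r M : ℝ} {U : Set E}

theorem norm_fderiv_le_of_forall_mem_ball (hr : 0 < r) (hf : DifferentiableOn ℂ f (ball z r))
    (hM : ∀ w ∈ ball z r, ‖f w‖ ≤ M) : ‖fderiv ℂ f z‖ ≤ 2 * M / r := by
  refine Complex.norm_fderiv_le_div_of_mapsTo_ball hf (fun w hw => ?_) hr
  rw [mem_closedBall_iff_norm, two_mul]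
  exact norm_sub_le_of_le (hM w hw) (hM z (mem_ball_self hr))

theorem norm_sub_le_of_forall_mem_ball (hr : 0 < r) (hf : DifferentiableOn ℂ f (ball z (2 * r)))
    (hM : ∀ w ∈ ball z (2 * r), ‖f w‖ ≤ M) {x y : E} (hx : x ∈ ball z r) (hy : y ∈ ball z r) :
    ‖f y - f x‖ ≤ 2 * M / r * ‖y - x‖ := by
  have hball : ∀ w ∈ ball z r, ball w r ⊆ ball z (2 * r) := fun w hw =>
    ball_subset_ball' (by rw [mem_ball] at hw; linarith)
  refine (convex_ball z r).norm_image_sub_le_of_norm_fderiv_le (𝕜 := ℂ) (fun w hw => ?_)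
    (fun w hw => ?_) hx hy
  · exact hf.differentiableAt (isOpen_ball.mem_nhds (hball w hw (mem_ball_self hr)))
  · exact norm_fderiv_le_of_forall_mem_ball hr (hf.mono (hball w hw))
      fun u hu => hM u (hball w hw hu)

theorem norm_fderiv_sub_le_of_forall_mem_ball (hr : 0 < r)
    (hf : DifferentiableOn ℂ f (ball z (4 * r))) (hM : ∀ w ∈ ball z (4 * r), ‖f w‖ ≤ M) {h : E}
    (hh : ‖h‖ < r) : ‖fderiv ℂ f (z + h) - fderiv ℂ f z‖ ≤ 2 * M / r ^ 2 * ‖h‖ := by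
  have hmem : ∀ w ∈ ball z r, w ∈ ball z (2 * r) ∧ w + h ∈ ball z (2 * r) := by
    intro w hw
    rw [mem_ball_iff_norm] at hw
    simp only [mem_ball_iff_norm]
    refine ⟨by linarith, ?_⟩
    rw [add_sub_right_comm, two_mul]
    exact (norm_add_le _ _).trans_lt (add_lt_add hw hh)
  have hdiff : ∀ w ∈ ball z (2 * r), DifferentiableAt ℂ f w := fun w hw =>
    hf.differentiableAt (isOpen_ball.mem_nhds (ball_subset_ball (by linarith) hw))
  have hshift : ∀ w ∈ ball z r, DifferentiableAt ℂ (fun w => f (w + h)) w := fun w hw =>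
    (differentiableAt_comp_add_right h).2 (hdiff _ (hmem w hw).2)
  have hzr : z ∈ ball z r := mem_ball_self hr
  have hdifference := norm_fderiv_le_of_forall_mem_ball (f := fun w => f (w + h) - f w)
    (M := M / r * ‖h‖) hr
    (fun w hw => ((hshift w hw).sub (hdiff w (hmem w hw).1)).differentiableWithinAt) fun w hw => by
      have := norm_sub_le_of_forall_mem_ball (r := 2 * r) (by positivity)
        (by rwa [← mul_assoc, show (2 : ℝ) * 2 = 4 by norm_num])
        (by rwa [← mul_assoc, show (2 : ℝ) * 2 = 4 by norm_num]) (hmem w hw).1 (hmem w hw).2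
      rwa [add_sub_cancel_left, mul_div_mul_left M r two_ne_zero] at this
  rw [fderiv_fun_sub (hshift z hzr) (hdiff z (hmem z hzr).1), fderiv_comp_add_right] at hdifference
  calc ‖fderiv ℂ f (z + h) - fderiv ℂ f z‖ ≤ 2 * (M / r * ‖h‖) / r := hdifference
    _ = 2 * M / r ^ 2 * ‖h‖ := by ring

theorem continuousOn_fderiv_of_differentiableOn (hU : IsOpen U) (hf : DifferentiableOn ℂ f U) :
    ContinuousOn (fderiv ℂ f) U := by
  intro z hz
  have hbdd : ∀ᶠ w in 𝓝 z, w ∈ U ∧ ‖f w‖ ≤ ‖f z‖ + 1 :=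
    (hU.eventually_mem hz).and
      ((hf.differentiableAt (hU.mem_nhds hz)).continuousAt.norm.eventually_le_const (by simp))
  obtain ⟨R, hR, hball⟩ := Metric.eventually_nhds_iff_ball.1 hbdd
  have hr : 0 < R / 4 := by positivity
  have hR4 : 4 * (R / 4) = R := by ring
  refine (continuousAt_of_locally_lipschitz hr (2 * (‖f z‖ + 1) / (R / 4) ^ 2)
    fun w hw => ?_).continuousWithinAt
  have := norm_fderiv_sub_le_of_forall_mem_ball (f := f) (z := z) (h := w - z) hr
    (hf.mono fun u hu => (hball u (hR4 ▸ hu)).1) (fun u hu => (hball u (hR4 ▸ hu)).2)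
    (by rwa [← dist_eq_norm])
  rwa [add_sub_cancel, ← dist_eq_norm, ← dist_eq_norm] at this

theorem differentiableOn_tsum_of_norm_le [CompleteSpace F] {ι : Type*} {φ : ι → E → F} {u : ι → ℝ}
    (hU : IsOpen U) (hu : Summable u) (hφ : ∀ i, DifferentiableOn ℂ (φ i) U)
    (hb : ∀ i, ∀ z ∈ U, ‖φ i z‖ ≤ u i) : DifferentiableOn ℂ (fun z => ∑' i, φ i z) U := by
  intro z hz
  obtain ⟨r, hr, hrU⟩ := Metric.isOpen_iff.1 hU z hz
  have hsub : ∀ w ∈ ball z (r / 2), ball w (r / 2) ⊆ U := fun w hw =>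
    (ball_subset_ball' (by rw [mem_ball] at hw; linarith)).trans hrU
  have hzz : z ∈ ball z (r / 2) := mem_ball_self (by positivity)
  have hsum := hasFDerivAt_tsum_of_isPreconnected (𝕜 := ℂ) (f := φ)
    (f' := fun i w => fderiv ℂ (φ i) w) ((hu.mul_left 2).div_const (r / 2)) isOpen_ball
    (convex_ball z (r / 2)).isPreconnected
    (fun i w hw => ((hφ i).differentiableAt (hU.mem_nhds
      (hsub w hw (mem_ball_self (by positivity))))).hasFDerivAt)
    (fun i w hw => norm_fderiv_le_of_forall_mem_ball (by positivity) ((hφ i).mono (hsub w hw))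
      fun x hx => hb i x (hsub w hw hx))
    hzz (Summable.of_norm_bounded hu fun i => hb i z hz) hzz
  exact hsum.differentiableAt.differentiableWithinAt

theorem eqOn_of_convex_of_eventuallyEq [CompleteSpace F] (hU : IsOpen U) (hUc : Convex ℝ U)
    (hf : DifferentiableOn ℂ f U) (hg : DifferentiableOn ℂ g U) (hz : z ∈ U)
    (hfg : f =ᶠ[𝓝 z] g) : EqOn f g U := by
  intro w hw
  set L : ℂ →ᵃ[ℂ] E := AffineMap.lineMap z w
  have hL : Differentiable ℂ L := AffineMap.lineMap z w |>.differentiable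
  have hopen : IsOpen (L ⁻¹' U) := hU.preimage hL.continuous
  have hconvex : Convex ℝ (L ⁻¹' U) := hUc.affine_preimage
    { toFun := L, linear := L.linear.restrictScalars ℝ, map_vadd' := L.map_vadd }
  have hana : ∀ {φ : E → F}, DifferentiableOn ℂ φ U → AnalyticOnNhd ℂ (φ ∘ L) (L ⁻¹' U) :=
    fun hφ => (hφ.comp hL.differentiableOn fun _ => id).analyticOnNhd hopen
  have hzL : L 0 = z := AffineMap.lineMap_apply_zero z w
  have hwL : L 1 = w := AffineMap.lineMap_apply_one z w
  have hev : f ∘ L =ᶠ[𝓝 0] g ∘ L :=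
    (hzL ▸ hL.continuous.continuousAt : Tendsto L (𝓝 0) (𝓝 z)).eventually hfg
  have heq := (hana hf).eqOn_of_preconnected_of_eventuallyEq (hana hg) hconvex.isPreconnected
    (show L 0 ∈ U from hzL ▸ hz) hev (show L 1 ∈ U from hwL ▸ hw)
  simpa only [Function.comp_apply, hwL] using heq

theorem eqOn_of_isPreconnected_of_eventuallyEq [CompleteSpace F] (hU : IsOpen U)
    (hUc : IsPreconnected U) (hf : DifferentiableOn ℂ f U) (hg : DifferentiableOn ℂ g U)
    (hz : z ∈ U) (hfg : f =ᶠ[𝓝 z] g) : EqOn f g U := by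
  have hsub : U ⊆ {w | f =ᶠ[𝓝 w] g} := by
    refine hUc.subset_of_closure_inter_subset isOpen_setOfPred_eventually_nhds ⟨z, hz, hfg⟩ ?_
    rintro w ⟨hw, hwU⟩
    obtain ⟨r, hr, hrU⟩ := Metric.isOpen_iff.1 hU w hwU
    obtain ⟨u, hu, hfgu⟩ := mem_closure_iff_nhds.1 hw (ball w r) (ball_mem_nhds w hr)
    exact (eqOn_of_convex_of_eventuallyEq isOpen_ball (convex_ball w r) (hf.mono hrU)
      (hg.mono hrU) hu hfgu).eventuallyEq_of_mem (ball_mem_nhds w hr)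
  exact fun w hw => (hsub hw).eq_of_nhds

end Holomorphic

section Connectedness

open Topology Metric

theorem isPreconnected_of_subset_closure_of_locally {X : Type*} [TopologicalSpace X] {S T : Set X}
    (hT : IsPreconnected T) (hST : S ⊆ T) (hTS : T ⊆ closure S)
    (hloc : ∀ p ∈ T, ∃ P ∈ 𝓝 p, IsPreconnected (P ∩ S)) : IsPreconnected S := by
  intro U V hU hV hSUV hSU hSV
  have hcover : T ⊆ closure (S ∩ U) ∪ closure (S ∩ V) := by
    rwa [← closure_union, ← inter_union_distrib_left, inter_eq_left.2 hSUV]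
  have hmeets : ∀ W, (S ∩ W).Nonempty → (T ∩ closure (S ∩ W)).Nonempty :=
    fun W ⟨x, hx⟩ => ⟨x, hST hx.1, subset_closure hx⟩
  obtain ⟨p, hpT, hpU, hpV⟩ := isPreconnected_closed_iff.1 hT _ _ isClosed_closure isClosed_closure
    hcover (hmeets U hSU) (hmeets V hSV)
  obtain ⟨P, hP, hPc⟩ := hloc p hpT
  obtain ⟨x, hxP, hxS, hxU⟩ := mem_closure_iff_nhds.1 hpU P hP
  obtain ⟨y, hyP, hyS, hyV⟩ := mem_closure_iff_nhds.1 hpV P hP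
  obtain ⟨w, ⟨-, hwS⟩, hwUV⟩ := hPc U V hU hV (inter_subset_right.trans hSUV)
    ⟨x, ⟨hxP, hxS⟩, hxU⟩ ⟨y, ⟨hyP, hyS⟩, hyV⟩
  exact ⟨w, hwS, hwUV⟩

theorem isPreconnected_ball_diff_singleton {E : Type*} [NormedAddCommGroup E]
    [NormedSpace ℝ E] (hrank : 1 < Module.rank ℝ E) (a c : E) (r : ℝ) :
    IsPreconnected (ball c r \ {a}) := by
  by_cases ha : a ∈ ball c r
  · have hr : 0 < r := pos_of_mem_ball ha
    set e := OpenPartialHomeomorph.univBall c r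
    have htarget : e.target = ball c r := OpenPartialHomeomorph.univBall_target c hr
    have hsource : e.source = univ := OpenPartialHomeomorph.univBall_source c r
    have himage : e '' {e.symm a}ᶜ = ball c r \ {a} := by
      have hinj : Function.Injective e := by
        rw [← injOn_univ, ← hsource]
        exact e.injOn
      rw [image_compl_eq_range_sdiff_image hinj, image_singleton, e.right_inv (htarget ▸ ha),
        ← image_univ, ← hsource, e.image_source_eq_target, htarget]
    rw [← himage]
    exact (isConnected_compl_singleton_of_one_lt_rank hrank (e.symm a)).isPreconnected.image e
      (e.continuousOn.mono (hsource ▸ subset_univ _))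
  · rw [sdiff_singleton_eq_self ha]
    exact (convex_ball c r).isPreconnected

end Connectedness

section Nonvanishing

/-- The complex torus `(ℂ \ {0})^ι`: the points all of whose coordinates are nonzero. The
logarithmic image of a circled set only sees the part of the set in here. -/
def nonvanishing (ι : Type*) : Set (ι → ℂ) := {z | ∀ j, z j ≠ 0}

variable {ι : Type*}

theorem nonvanishing_eq_pi : nonvanishing ι = univ.pi fun _ => ({0}ᶜ : Set ℂ) := by
  ext z
  simp [nonvanishing]

theorem dense_nonvanishing : Dense (nonvanishing ι) := by
  rw [nonvanishing_eq_pi]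
  exact dense_pi univ fun _ _ => dense_compl_singleton 0

theorem isOpen_nonvanishing [Finite ι] : IsOpen (nonvanishing ι) := by
  rw [nonvanishing_eq_pi]
  exact isOpen_set_pi finite_univ fun _ _ => isOpen_compl_singleton

open Metric Topology in
theorem isPreconnected_inter_nonvanishing [Finite ι] {G : Set (ι → ℂ)} (hG : IsOpen G)
    (hconn : IsPreconnected G) : IsPreconnected (G ∩ nonvanishing ι) := by
  have := Fintype.ofFinite ι
  refine isPreconnected_of_subset_closure_of_locally hconn inter_subset_left
    (dense_nonvanishing.open_subset_closure_inter hG) fun p hp => ?_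
  obtain ⟨r, hr, hrG⟩ := Metric.isOpen_iff.1 hG p hp
  refine ⟨ball p r, ball_mem_nhds p hr, ?_⟩
  rw [← inter_assoc, inter_eq_left.2 hrG, ball_pi p hr, nonvanishing_eq_pi, ← pi_inter_distrib]
  exact isPreconnected_univ_pi fun i =>
    isPreconnected_ball_diff_singleton (Complex.rank_real_complex ▸ Nat.one_lt_ofNat) 0 (p i) r

end Nonvanishing

section Summability

theorem summable_prod_apply_of_nonneg {κ : Type*} {g : κ → ℝ} (hg0 : ∀ k, 0 ≤ g k)
    (hg : Summable g) : ∀ n : ℕ, Summable fun α : Fin n → κ => ∏ j, g (α j)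
  | 0 => Summable.of_finite
  | n + 1 => by
    have hmul := hg.mul_of_nonneg (summable_prod_apply_of_nonneg hg0 hg n) hg0
      fun α => Finset.prod_nonneg fun j _ => hg0 (α j)
    rw [← (Fin.consEquiv fun _ : Fin (n + 1) => κ).summable_iff]
    refine hmul.congr fun p => ?_
    simp [Fin.prod_univ_succ, Fin.consEquiv]

theorem summable_inv_zpow_abs {ρ : ℝ} (hρ : 1 < ρ) : Summable fun k : ℤ => (ρ ^ |k|)⁻¹ :=
  have hgeom : Summable fun k : ℕ => (ρ ^ k)⁻¹ := by
    simpa only [inv_pow] using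
      summable_geometric_of_lt_one (by positivity) (inv_lt_one_of_one_lt₀ hρ)
  .of_nat_of_neg (by simpa using hgeom) (by simpa using hgeom)

end Summability

section LaurentMonomial

/-- The Laurent monomial `z ↦ z^α = ∏ⱼ zⱼ^{αⱼ}`. Where a coordinate with negative exponent vanishes
it takes a junk value. -/
noncomputable def laurentMonomial {ι : Type*} [Fintype ι] (α : ι → ℤ) (z : ι → ℂ) : ℂ :=
  ∏ j, z j ^ α j

variable {ι : Type*} [Fintype ι] (α : ι → ℤ)

theorem laurentMonomial_mul (z w : ι → ℂ) :
    laurentMonomial α (z * w) = laurentMonomial α z * laurentMonomial α w := by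
  simp [laurentMonomial, mul_zpow, Finset.prod_mul_distrib]

theorem norm_laurentMonomial (z : ι → ℂ) : ‖laurentMonomial α z‖ = ∏ j, ‖z j‖ ^ α j := by
  simp [laurentMonomial]

theorem laurentMonomial_neg_mul_self {z : ι → ℂ} (hz : z ∈ nonvanishing ι) :
    laurentMonomial (-α) z * laurentMonomial α z = 1 := by
  rw [laurentMonomial, laurentMonomial, ← Finset.prod_mul_distrib]
  refine Finset.prod_eq_one fun j _ => ?_
  rw [Pi.neg_apply, zpow_neg, inv_mul_cancel₀ (zpow_ne_zero _ (hz j))]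

theorem differentiableAt_laurentMonomial {z : ι → ℂ} (hz : ∀ j, z j = 0 → 0 ≤ α j) :
    DifferentiableAt ℂ (laurentMonomial α) z := by
  classical
  refine (HasFDerivAt.finsetProd (u := Finset.univ) (g := fun j (z : ι → ℂ) => z j ^ α j)
    fun j _ => DifferentiableAt.hasFDerivAt ?_).differentiableAt
  exact (differentiableAt_zpow.2 (or_iff_not_imp_left.2 fun h => hz j (not_not.1 h))).comp z
    (differentiableAt_apply (𝕜 := ℂ) j z)

end LaurentMonomial

section Torus

variable {ι : Type*}

/-- The point `(e^{2πiθⱼ})ⱼ` of the unit torus, parametrised by the additive torus. -/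
noncomputable def torusPoint (θ : UnitAddTorus ι) : ι → ℂ := fun j => fourier 1 (θ j)

theorem norm_torusPoint_apply (θ : UnitAddTorus ι) (j : ι) : ‖torusPoint θ j‖ = 1 :=
  Circle.norm_coe _

theorem torusPoint_mem_nonvanishing (θ : UnitAddTorus ι) : torusPoint θ ∈ nonvanishing ι :=
  fun j => norm_ne_zero_iff.1 (norm_torusPoint_apply θ j ▸ one_ne_zero)

theorem continuous_torusPoint : Continuous (torusPoint (ι := ι)) := by
  unfold torusPoint
  fun_prop

theorem torusPoint_zero : torusPoint (0 : UnitAddTorus ι) = 1 := by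
  ext j
  simp [torusPoint]

theorem torusPoint_add (θ φ : UnitAddTorus ι) :
    torusPoint (θ + φ) = torusPoint θ * torusPoint φ := by
  ext j
  simp [torusPoint, fourier_apply, AddCircle.toCircle_add]

theorem torusPoint_single_mul [DecidableEq ι] (j : ι) (t : ℝ) (z : ι → ℂ) :
    torusPoint (Pi.single j (t : UnitAddCircle)) * z =
      Function.update z j (Complex.exp (2 * Real.pi * Complex.I * t) * z j) := by
  ext i
  rcases eq_or_ne i j with rfl | hij
  · simp only [torusPoint, Pi.mul_apply, Pi.single_eq_same, fourier_coe_apply, Int.cast_one,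
      Complex.ofReal_one, mul_one, div_one, Function.update_self]
  · simp [torusPoint, hij]

theorem laurentMonomial_torusPoint [Fintype ι] (α : ι → ℤ) (θ : UnitAddTorus ι) :
    laurentMonomial α (torusPoint θ) = UnitAddTorus.mFourier α θ := by
  simp [laurentMonomial, torusPoint, UnitAddTorus.mFourier, fourier_apply,
    AddCircle.toCircle_zsmul]

theorem norm_mFourier_apply [Fintype ι] (α : ι → ℤ) (θ : UnitAddTorus ι) :
    ‖UnitAddTorus.mFourier α θ‖ = 1 := by
  rw [← laurentMonomial_torusPoint, norm_laurentMonomial]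
  simp [norm_torusPoint_apply]

theorem fderiv_single_eq_zero_of_torus_invariant [DecidableEq ι] [Finite ι] {F : Type*}
    [NormedAddCommGroup F] [NormedSpace ℂ F] {A : (ι → ℂ) → F} {z : ι → ℂ}
    (hA : DifferentiableAt ℂ A z) (hinv : ∀ θ, A (torusPoint θ * z) = A z) {j : ι}
    (hz : z j ≠ 0) : fderiv ℂ A z (Pi.single j 1) = 0 := by
  have := Fintype.ofFinite ι
  have hrotate : HasDerivAt (fun t : ℝ => Complex.exp (2 * Real.pi * Complex.I * t) * z j)
      (2 * Real.pi * Complex.I * z j) 0 := by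
    have hlin := (Complex.ofRealCLM.hasDerivAt (x := 0)).const_mul
      (2 * (Real.pi : ℂ) * Complex.I)
    simpa using (hlin.cexp).mul_const (z j)
  have hpath := (hasDerivAt_update z j (z j)).scomp_of_eq (𝕜 := ℝ) 0 hrotate (by simp)
  have hcomp := (hA.hasFDerivAt.restrictScalars ℝ).comp_hasDerivAt_of_eq 0 hpath (by simp)
  have hconst : A ∘ Function.update z j ∘
      (fun t : ℝ => Complex.exp (2 * Real.pi * Complex.I * t) * z j) = fun _ => A z := by
    ext t
    rw [Function.comp_apply, Function.comp_apply, ← torusPoint_single_mul, hinv]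
  rw [hconst] at hcomp
  simpa [hz, Real.pi_ne_zero] using hcomp.unique (hasDerivAt_const 0 (A z))

theorem fderiv_eq_zero_of_torus_invariant [Finite ι] {F : Type*} [NormedAddCommGroup F]
    [NormedSpace ℂ F] {A : (ι → ℂ) → F} {z : ι → ℂ} (hz : z ∈ nonvanishing ι)
    (hA : DifferentiableAt ℂ A z) (hinv : ∀ θ, A (torusPoint θ * z) = A z) :
    fderiv ℂ A z = 0 := by
  classical
  refine ContinuousLinearMap.coe_injective (LinearMap.pi_ext' fun j => LinearMap.ext_ring ?_)
  simpa using fderiv_single_eq_zero_of_torus_invariant hA hinv (hz j)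

end Torus

section TorusMeasure

/-- The normalized Haar measure of the torus, against which `UnitAddTorus.mFourierCoeff` integrates
(Mathlib keeps the corresponding `MeasureSpace` instance local). -/
noncomputable def torusMeasure (ι : Type*) [Fintype ι] : Measure (UnitAddTorus ι) :=
  Measure.pi fun _ => AddCircle.haarAddCircle

variable {ι : Type*} [Fintype ι]

instance : IsProbabilityMeasure (torusMeasure ι) := by
  unfold torusMeasure
  infer_instance

instance : (torusMeasure ι).IsAddHaarMeasure := by
  unfold torusMeasure
  infer_instance

theorem integrable_torusMeasure_of_continuous {F : Type*} [NormedAddCommGroup F]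
    {g : UnitAddTorus ι → F} (hg : Continuous g) : Integrable g (torusMeasure ι) :=
  hg.integrable_of_hasCompactSupport (HasCompactSupport.of_compactSpace g)

end TorusMeasure

namespace IsNCircled

variable {n : ℕ} {G : Set (Fin n → ℂ)}

theorem mul_mem (hG : IsNCircled G) {u z : Fin n → ℂ} (hu : ∀ j, ‖u j‖ = 1) (hz : z ∈ G) :
    u * z ∈ G := by
  have hpolar : ∀ j, Complex.exp (Complex.I * Complex.arg (u j)) = u j := fun j => by
    simpa [hu j, mul_comm] using Complex.norm_mul_exp_arg_mul_I (u j)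
  change (fun j => u j * z j) ∈ G
  simpa only [hpolar] using hG z hz fun j => Complex.arg (u j)

theorem torusPoint_mul_mem (hG : IsNCircled G) (θ : UnitAddTorus (Fin n)) {z : Fin n → ℂ}
    (hz : z ∈ G) : torusPoint θ * z ∈ G :=
  hG.mul_mem (norm_torusPoint_apply θ) hz

theorem mem_of_norm_eq (hG : IsNCircled G) {z w : Fin n → ℂ} (hzw : ∀ j, ‖z j‖ = ‖w j‖)
    (hz : z ∈ G) : w ∈ G := by
  have hrotate : ∀ j, ∃ u : ℂ, ‖u‖ = 1 ∧ u * z j = w j := fun j => by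
    rcases eq_or_ne (z j) 0 with h0 | h0
    · have hw : w j = 0 := norm_eq_zero.1 (by rw [← hzw j, h0, norm_zero])
      exact ⟨1, norm_one, by rw [h0, hw, mul_zero]⟩
    · refine ⟨w j / z j, ?_, div_mul_cancel₀ _ h0⟩
      rw [norm_div, ← hzw j, div_self (norm_ne_zero_iff.2 h0)]
  choose u hu huz using hrotate
  have hw : u * z = w := funext huz
  exact hw ▸ hG.mul_mem hu hz

end IsNCircled

section LaurentCoefficients

open Filter Metric Topology

/-- The coefficient function `z ↦ ∫ e^{-2πi⟨α,θ⟩} f(e^{2πiθ} z) dθ` of a function on a circled set;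
for holomorphic `f` on a circled domain it is the `α`-th term `a_α z^α` of the Laurent expansion. -/
noncomputable def laurentCoeffFun {ι : Type*} [Fintype ι] (f : (ι → ℂ) → ℂ) (α : ι → ℤ)
    (z : ι → ℂ) : ℂ :=
  UnitAddTorus.mFourierCoeff (fun θ => f (torusPoint θ * z)) α

section Basic

variable {ι : Type*} [Fintype ι]

theorem laurentCoeffFun_eq_integral (f : (ι → ℂ) → ℂ) (α : ι → ℤ) (z : ι → ℂ) :
    laurentCoeffFun f α z =
      ∫ θ, UnitAddTorus.mFourier (-α) θ * f (torusPoint θ * z) ∂torusMeasure ι :=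
  rfl

theorem norm_laurentCoeffFun_le {f : (ι → ℂ) → ℂ} (α : ι → ℤ) {z : ι → ℂ} {M : ℝ}
    (hM : ∀ θ, ‖f (torusPoint θ * z)‖ ≤ M) : ‖laurentCoeffFun f α z‖ ≤ M := by
  have hbound := norm_integral_le_of_norm_le_const (μ := torusMeasure ι) (C := M)
    (f := fun θ => UnitAddTorus.mFourier (-α) θ * f (torusPoint θ * z)) (.of_forall fun θ => by
      rw [norm_mul, norm_mFourier_apply, one_mul]
      exact hM θ)
  simpa [laurentCoeffFun_eq_integral] using hbound

theorem laurentCoeffFun_torusPoint_mul (f : (ι → ℂ) → ℂ) (α : ι → ℤ) (φ : UnitAddTorus ι)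
    (z : ι → ℂ) : laurentCoeffFun f α (torusPoint φ * z) =
      laurentMonomial α (torusPoint φ) * laurentCoeffFun f α z := by
  rw [laurentCoeffFun_eq_integral, laurentCoeffFun_eq_integral, ← integral_const_mul]
  refine Eq.trans (integral_congr_ae (.of_forall fun θ => ?_))
    (integral_add_right_eq_self (μ := torusMeasure ι) _ φ)
  have hinv := laurentMonomial_neg_mul_self α (torusPoint_mem_nonvanishing φ)
  simp only [← laurentMonomial_torusPoint, torusPoint_add, laurentMonomial_mul, ← mul_assoc]
  linear_combination
    (-laurentMonomial (-α) (torusPoint θ) * f (torusPoint θ * torusPoint φ * z)) * hinv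

/-- The derivative in `z` of the integrand of `laurentCoeffFun f α z`. -/
noncomputable def laurentCoeffIntegrandFDeriv (f : (ι → ℂ) → ℂ) (α : ι → ℤ) (z : ι → ℂ)
    (θ : UnitAddTorus ι) : (ι → ℂ) →L[ℂ] ℂ :=
  UnitAddTorus.mFourier (-α) θ • (fderiv ℂ f (torusPoint θ * z)).comp
    (ContinuousLinearMap.mul ℂ (ι → ℂ) (torusPoint θ))

theorem hasFDerivAt_laurentCoeff_integrand {f : (ι → ℂ) → ℂ} (α : ι → ℤ) {z : ι → ℂ}
    {θ : UnitAddTorus ι} (hf : DifferentiableAt ℂ f (torusPoint θ * z)) :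
    HasFDerivAt (fun w => UnitAddTorus.mFourier (-α) θ * f (torusPoint θ * w))
      (laurentCoeffIntegrandFDeriv f α z θ) z :=
  (hf.hasFDerivAt.comp z
    (ContinuousLinearMap.mul ℂ (ι → ℂ) (torusPoint θ)).hasFDerivAt).const_mul _

theorem norm_laurentCoeffIntegrandFDeriv_single [DecidableEq ι] (f : (ι → ℂ) → ℂ) (α : ι → ℤ)
    (z : ι → ℂ) (θ : UnitAddTorus ι) (j : ι) :
    ‖laurentCoeffIntegrandFDeriv f α z θ (Pi.single j 1)‖ =
      ‖fderiv ℂ f (torusPoint θ * z) (Pi.single j 1)‖ := by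
  have hmul : torusPoint θ * Pi.single j 1 = torusPoint θ j • (Pi.single j 1 : ι → ℂ) := by
    ext i
    rcases eq_or_ne i j with rfl | hij <;> simp [*]
  simp only [laurentCoeffIntegrandFDeriv, FunLike.coe_smul, Pi.smul_apply,
    ContinuousLinearMap.coe_comp, Function.comp_apply, ContinuousLinearMap.mul_apply', hmul,
    map_smul, norm_smul, norm_mFourier_apply, norm_torusPoint_apply, one_mul]

end Basic

variable {n : ℕ} {G : Set (Fin n → ℂ)} {f : (Fin n → ℂ) → ℂ} {z : Fin n → ℂ}

theorem IsNCircled.continuous_comp_torusPoint_mul (hc : IsNCircled G) (hf : ContinuousOn f G)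
    (hz : z ∈ G) : Continuous fun θ => f (torusPoint θ * z) :=
  hf.comp_continuous (continuous_torusPoint.mul continuous_const)
    fun θ => hc.torusPoint_mul_mem θ hz

theorem IsNCircled.continuous_laurentCoeff_integrand (hc : IsNCircled G) (hf : ContinuousOn f G)
    (α : Fin n → ℤ) (hz : z ∈ G) :
    Continuous fun θ => UnitAddTorus.mFourier (-α) θ * f (torusPoint θ * z) :=
  (map_continuous _).mul (hc.continuous_comp_torusPoint_mul hf hz)

theorem IsNCircled.continuousOn_laurentCoeffIntegrandFDeriv (hc : IsNCircled G) (hG : IsOpen G)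
    (hf : DifferentiableOn ℂ f G) (α : Fin n → ℤ) :
    ContinuousOn (fun p : (Fin n → ℂ) × UnitAddTorus (Fin n) =>
      laurentCoeffIntegrandFDeriv f α p.1 p.2) (G ×ˢ univ) := by
  have htorus : Continuous fun p : (Fin n → ℂ) × UnitAddTorus (Fin n) => torusPoint p.2 :=
    continuous_torusPoint.comp continuous_snd
  refine ContinuousOn.smul ((map_continuous (UnitAddTorus.mFourier (-α))).comp
    continuous_snd).continuousOn (ContinuousOn.clm_comp ?_ ?_)
  · exact (continuousOn_fderiv_of_differentiableOn hG hf).comp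
      (htorus.mul continuous_fst).continuousOn fun p hp => hc.torusPoint_mul_mem p.2 hp.1
  · exact ((ContinuousLinearMap.mul ℂ (Fin n → ℂ)).continuous.comp htorus).continuousOn

theorem IsNCircled.integrable_laurentCoeffIntegrandFDeriv (hc : IsNCircled G) (hG : IsOpen G)
    (hf : DifferentiableOn ℂ f G) (α : Fin n → ℤ) (hz : z ∈ G) :
    Integrable (laurentCoeffIntegrandFDeriv f α z) (torusMeasure (Fin n)) :=
  integrable_torusMeasure_of_continuous <|
    (hc.continuousOn_laurentCoeffIntegrandFDeriv hG hf α).comp_continuous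
      (f := fun θ => (z, θ)) (by fun_prop) fun θ => ⟨hz, mem_univ θ⟩

theorem IsNCircled.hasFDerivAt_laurentCoeffFun (hc : IsNCircled G) (hG : IsOpen G)
    (hf : DifferentiableOn ℂ f G) (α : Fin n → ℤ) (hz : z ∈ G) :
    HasFDerivAt (laurentCoeffFun f α)
      (∫ θ, laurentCoeffIntegrandFDeriv f α z θ ∂torusMeasure (Fin n)) z := by
  obtain ⟨r, hr, hrG⟩ := nhds_basis_closedBall.mem_iff.1 (hG.mem_nhds hz)
  obtain ⟨B, hB⟩ := ((isCompact_closedBall z r).prod isCompact_univ).exists_bound_of_continuousOn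
    ((hc.continuousOn_laurentCoeffIntegrandFDeriv hG hf α).mono (prod_mono_left hrG))
  have hint : ∀ w ∈ closedBall z r,
      Integrable (fun θ => UnitAddTorus.mFourier (-α) θ * f (torusPoint θ * w))
        (torusMeasure (Fin n)) := fun w hw =>
    integrable_torusMeasure_of_continuous
      (hc.continuous_laurentCoeff_integrand hf.continuousOn α (hrG hw))
  refine hasFDerivAt_integral_of_dominated_of_fderiv_le (μ := torusMeasure (Fin n))
    (bound := fun _ => B) (closedBall_mem_nhds z hr) ?_ (hint z (mem_closedBall_self hr.le))
    (hc.integrable_laurentCoeffIntegrandFDeriv hG hf α hz).aestronglyMeasurable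
    (.of_forall fun θ w hw => hB (w, θ) ⟨hw, mem_univ θ⟩) (integrable_const B)
    (.of_forall fun θ w hw => hasFDerivAt_laurentCoeff_integrand α
      (hf.differentiableAt (hG.mem_nhds (hc.torusPoint_mul_mem θ (hrG hw)))))
  filter_upwards [closedBall_mem_nhds z hr] with w hw
  exact (hint w hw).aestronglyMeasurable

theorem IsNCircled.norm_fderiv_laurentCoeffFun_single_le (hc : IsNCircled G) (hG : IsOpen G)
    (hf : DifferentiableOn ℂ f G) (α : Fin n → ℤ) {j : Fin n} {M : ℝ}
    (hM : ∀ z ∈ G, ‖fderiv ℂ f z (Pi.single j 1)‖ ≤ M) (hz : z ∈ G) :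
    ‖fderiv ℂ (laurentCoeffFun f α) z (Pi.single j 1)‖ ≤ M := by
  rw [(hc.hasFDerivAt_laurentCoeffFun hG hf α hz).fderiv, ContinuousLinearMap.integral_apply
    (hc.integrable_laurentCoeffIntegrandFDeriv hG hf α hz)]
  refine (norm_integral_le_of_norm_le_const (C := M) (.of_forall fun θ => ?_)).trans (by simp)
  rw [norm_laurentCoeffIntegrandFDeriv_single]
  exact hM _ (hc.torusPoint_mul_mem θ hz)

/-- `a` is the family of Laurent coefficients of `f` on the circled set `G`. The condition is
imposed off the coordinate hyperplanes, where Laurent monomials have no junk values. -/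
def IsLaurentCoeff (f : (Fin n → ℂ) → ℂ) (G : Set (Fin n → ℂ)) (a : (Fin n → ℤ) → ℂ) : Prop :=
  ∀ α, ∀ z ∈ G ∩ nonvanishing (Fin n), laurentCoeffFun f α z = a α * laurentMonomial α z

theorem IsNCircled.exists_isLaurentCoeff (hc : IsNCircled G) (hG : IsOpen G)
    (hconn : IsPreconnected G) (hf : DifferentiableOn ℂ f G) : ∃ a, IsLaurentCoeff f G a := by
  have hconst : ∀ α : Fin n → ℤ, ∃ a : ℂ, ∀ z ∈ G ∩ nonvanishing (Fin n),
      laurentCoeffFun f α z * laurentMonomial (-α) z = a := by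
    intro α
    have hd : ∀ z ∈ G ∩ nonvanishing (Fin n),
        DifferentiableAt ℂ (fun z => laurentCoeffFun f α z * laurentMonomial (-α) z) z :=
      fun z hz => (hc.hasFDerivAt_laurentCoeffFun hG hf α hz.1).differentiableAt.mul
        (differentiableAt_laurentMonomial _ fun j hj => absurd hj (hz.2 j))
    refine (hG.inter isOpen_nonvanishing).exists_is_const_of_fderiv_eq_zero
      (isPreconnected_inter_nonvanishing hG hconn)
      (fun z hz => (hd z hz).differentiableWithinAt) fun z hz => ?_
    refine fderiv_eq_zero_of_torus_invariant hz.2 (hd z hz) fun θ => ?_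
    rw [laurentCoeffFun_torusPoint_mul, laurentMonomial_mul]
    linear_combination (laurentCoeffFun f α z * laurentMonomial (-α) z) *
      laurentMonomial_neg_mul_self α (torusPoint_mem_nonvanishing θ)
  choose a ha using hconst
  refine ⟨a, fun α z hz => ?_⟩
  rw [← ha α z hz, mul_assoc, laurentMonomial_neg_mul_self α hz.2, mul_one]

end LaurentCoefficients

section SignScale

open Filter Topology SignType

variable {ι : Type*}

/-- The point `(ρ^{s₁} z₁, …, ρ^{sₙ} zₙ)` for a vector `s` of signs. For `s = sign α` and `ρ > 1`
the monomial `z^α` grows by the factor `ρ^{|α₁| + ⋯ + |αₙ|}`. -/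
noncomputable def signScale (ρ : ℝ) (s : ι → SignType) (z : ι → ℂ) : ι → ℂ :=
  fun j => (ρ : ℂ) ^ (s j : ℤ) * z j

theorem signScale_one (s : ι → SignType) (z : ι → ℂ) : signScale 1 s z = z := by
  ext j
  simp [signScale]

theorem norm_signScale_apply {ρ : ℝ} (hρ : 0 ≤ ρ) (s : ι → SignType) (z : ι → ℂ) (j : ι) :
    ‖signScale ρ s z j‖ = ρ ^ (s j : ℤ) * ‖z j‖ := by
  rw [signScale, norm_mul, norm_zpow, Complex.norm_of_nonneg hρ]

theorem norm_laurentMonomial_signScale [Fintype ι] {ρ : ℝ} (hρ : 0 ≤ ρ) (α : ι → ℤ) (z : ι → ℂ) :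
    ‖laurentMonomial α (signScale ρ (fun j => sign (α j)) z)‖ =
      (∏ j, ρ ^ |α j|) * ‖laurentMonomial α z‖ := by
  simp only [norm_laurentMonomial, norm_signScale_apply hρ, mul_zpow, ← zpow_mul, sign_mul_self,
    Finset.prod_mul_distrib]

theorem norm_laurentMonomial_le_signScale [Fintype ι] {ρ : ℝ} (hρ : 0 < ρ) {α : ι → ℤ}
    {z q : ι → ℂ} (hq : q ∈ nonvanishing ι) (hupper : ∀ j, ‖z j‖ ≤ ρ * ‖q j‖)
    (hlower : ∀ j, α j < 0 → ρ⁻¹ * ‖q j‖ ≤ ‖z j‖) :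
    ‖laurentMonomial α z‖ ≤ ‖laurentMonomial α (signScale ρ (fun j => sign (α j)) q)‖ := by
  rw [norm_laurentMonomial, norm_laurentMonomial]
  refine Finset.prod_le_prod (fun j _ => by positivity) fun j _ => ?_
  rw [norm_signScale_apply hρ.le]
  rcases lt_trichotomy (α j) 0 with hα | hα | hα
  · have hq0 : 0 < ‖q j‖ := norm_pos_iff.2 (hq j)
    rw [sign_neg hα, coe_neg_one, zpow_neg_one, ← inv_le_inv₀ (by positivity) (by
      have := hlower j hα
      have : 0 < ‖z j‖ := lt_of_lt_of_le (by positivity) this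
      positivity), ← zpow_neg, ← zpow_neg]
    exact zpow_le_zpow_left₀ (by omega) (by positivity) (hlower j hα)
  · rw [hα, zpow_zero, zpow_zero]
  · rw [sign_pos hα, coe_one, zpow_one]
    exact zpow_le_zpow_left₀ hα.le (norm_nonneg _) (hupper j)

theorem exists_signScale_mem [Finite ι] {U : Set (ι → ℂ)} (hU : IsOpen U) {z : ι → ℂ}
    (hz : z ∈ U) : ∃ ρ : ℝ, 1 < ρ ∧ ∀ s, signScale ρ s z ∈ U := by
  have hnhds : ∀ s, ∀ᶠ ρ : ℝ in 𝓝 1, signScale ρ s z ∈ U := by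
    intro s
    have hcont : ContinuousAt (fun ρ : ℝ => signScale ρ s z) 1 := continuousAt_pi.2 fun j =>
      (Complex.continuous_ofReal.continuousAt.zpow₀ _ (by simp)).mul continuousAt_const
    exact hcont.eventually_mem (hU.mem_nhds (by rwa [signScale_one]))
  obtain ⟨ρ, hρ, hρ1⟩ := (((eventually_all.2 hnhds).filter_mono nhdsWithin_le_nhds).and
    (self_mem_nhdsWithin (s := Ioi 1))).exists
  exact ⟨ρ, hρ1, hρ⟩

end SignScale

section LaurentSeries

open Filter Topology SignType

variable {n : ℕ} {G U : Set (Fin n → ℂ)} {f : (Fin n → ℂ) → ℂ} {a : (Fin n → ℤ) → ℂ}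
  {z : Fin n → ℂ}

theorem IsLaurentCoeff.norm_le_of_signScale_mem (ha : IsLaurentCoeff f G a) {ρ M : ℝ} (hρ : 0 < ρ)
    (hmem : ∀ s, signScale ρ s z ∈ G ∩ nonvanishing (Fin n))
    (hM : ∀ s θ, ‖f (torusPoint θ * signScale ρ s z)‖ ≤ M) (α : Fin n → ℤ) :
    ‖a α * laurentMonomial α z‖ ≤ M * ∏ j, (ρ ^ |α j|)⁻¹ := by
  have hcoeff := norm_laurentCoeffFun_le α (hM fun j => sign (α j))
  rw [ha α _ (hmem _), norm_mul, norm_laurentMonomial_signScale hρ.le, mul_left_comm,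
    ← norm_mul] at hcoeff
  rw [Finset.prod_inv_distrib, ← div_eq_mul_inv, le_div_iff₀' (by positivity)]
  exact hcoeff

theorem IsLaurentCoeff.summable_norm (ha : IsLaurentCoeff f G a) (hG : IsOpen G)
    (hc : IsNCircled G) (hf : ContinuousOn f G) (hz : z ∈ G ∩ nonvanishing (Fin n)) :
    Summable fun α => ‖a α * laurentMonomial α z‖ := by
  obtain ⟨ρ, hρ, hmem⟩ := exists_signScale_mem (hG.inter isOpen_nonvanishing) hz
  have hbdd : ∀ s, ∃ M, ∀ θ, ‖f (torusPoint θ * signScale ρ s z)‖ ≤ M := fun s => by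
    simpa using isCompact_univ.exists_bound_of_continuousOn
      (hc.continuous_comp_torusPoint_mul hf (hmem s).1).continuousOn
  choose M hM using hbdd
  obtain ⟨B, hB⟩ := Finite.exists_le M
  refine .of_nonneg_of_le (fun _ => norm_nonneg _)
    (ha.norm_le_of_signScale_mem (by positivity) hmem fun s θ => (hM s θ).trans (hB s)) ?_
  exact (summable_prod_apply_of_nonneg (fun k => by positivity)
    (summable_inv_zpow_abs hρ) n).mul_left B

theorem IsLaurentCoeff.hasSum (ha : IsLaurentCoeff f G a) (hG : IsOpen G) (hc : IsNCircled G)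
    (hf : ContinuousOn f G) (hz : z ∈ G ∩ nonvanishing (Fin n)) :
    HasSum (fun α => a α * laurentMonomial α z) (f z) := by
  let F : C(UnitAddTorus (Fin n), ℂ) :=
    ⟨fun θ => f (torusPoint θ * z), hc.continuous_comp_torusPoint_mul hf hz.1⟩
  have hcoeff : UnitAddTorus.mFourierCoeff F = fun α => a α * laurentMonomial α z :=
    funext fun α => ha α z hz
  have hsum := UnitAddTorus.hasSum_mFourier_series_apply_of_summable (f := F)
    (hcoeff ▸ (ha.summable_norm hG hc hf hz).of_norm) 0
  rw [hcoeff] at hsum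
  simpa [F, torusPoint_zero, UnitAddTorus.mFourier] using hsum

theorem exists_mem_nonvanishing_of_mem_open {ι : Type*} {U : Set (ι → ℂ)} (hU : IsOpen U)
    {p : ι → ℂ} (hp : p ∈ U) : ∃ q ∈ U ∩ nonvanishing ι, ∀ j, p j ≠ 0 → q j = p j := by
  classical
  let q : ℂ → ι → ℂ := fun t j => if p j = 0 then t else p j
  have hq : Continuous q := continuous_pi fun j => by
    by_cases hj : p j = 0 <;> simp only [q, hj, if_true, if_false] <;> fun_prop
  have hq0 : q 0 = p := funext fun j => by simp only [q, ite_eq_right_iff]; exact Eq.symm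
  have hqU : ∀ᶠ t in 𝓝 0, q t ∈ U := hq.continuousAt.eventually_mem (hU.mem_nhds (hq0.symm ▸ hp))
  obtain ⟨t, htU, ht⟩ := ((hqU.filter_mono nhdsWithin_le_nhds).and
    (self_mem_nhdsWithin (s := {(0 : ℂ)}ᶜ))).exists
  refine ⟨q t, ⟨htU, fun j => ?_⟩, fun j hj => if_neg hj⟩
  by_cases hj : p j = 0
  · simpa [q, hj] using ht
  · simp [q, hj]

theorem eventually_norm_mem_annuli {ι : Type*} [Finite ι] {p q : ι → ℂ}
    (hq : q ∈ nonvanishing ι) (hqp : ∀ j, p j ≠ 0 → q j = p j) {ρ : ℝ} (hρ : 1 < ρ) :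
    ∀ᶠ z in 𝓝 p, ∀ j, ‖z j‖ < ρ * ‖q j‖ ∧ (p j ≠ 0 → ρ⁻¹ * ‖q j‖ < ‖z j‖) := by
  refine eventually_all.2 fun j => ?_
  have hnorm : ContinuousAt (fun z : ι → ℂ => ‖z j‖) p :=
    (continuous_apply j).norm.continuousAt
  have hqj : 0 < ‖q j‖ := norm_pos_iff.2 (hq j)
  by_cases hj : p j = 0
  · have hlt : ‖p j‖ < ρ * ‖q j‖ := by
      rw [hj, norm_zero]
      positivity
    filter_upwards [hnorm.eventually_lt_const hlt] with z hz
    exact ⟨hz, fun h => absurd hj h⟩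
  · have hupper : ‖p j‖ < ρ * ‖q j‖ := hqp j hj ▸ lt_mul_of_one_lt_left hqj hρ
    have hlower : ρ⁻¹ * ‖q j‖ < ‖p j‖ :=
      hqp j hj ▸ mul_lt_of_lt_one_left hqj (inv_lt_one_of_one_lt₀ hρ)
    filter_upwards [hnorm.eventually_lt_const hupper, hnorm.eventually_const_lt hlower]
      with z hz1 hz2
    exact ⟨hz1, fun _ => hz2⟩

-- Near a point `p` of a coordinate hyperplane the series is dominated by its values at the finitely
-- many points `signScale ρ s q`, where `q` is a nearby point off the coordinate hyperplanes.
theorem differentiableOn_tsum_laurent (hU : IsOpen U)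
    (hs : ∀ z ∈ U ∩ nonvanishing (Fin n), Summable fun α => ‖a α * laurentMonomial α z‖)
    (hpos : ∀ p ∈ U, ∀ j, p j = 0 → ∀ α, a α ≠ 0 → 0 ≤ α j) :
    DifferentiableOn ℂ (fun z => ∑' α, a α * laurentMonomial α z) U := by
  intro p hp
  obtain ⟨q, hq, hqp⟩ := exists_mem_nonvanishing_of_mem_open hU hp
  obtain ⟨ρ, hρ, hmem⟩ := exists_signScale_mem (hU.inter isOpen_nonvanishing) hq
  obtain ⟨V, hV, hVo, hpV⟩ := eventually_nhds_iff.1 (eventually_norm_mem_annuli hq.2 hqp hρ)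
  have hzero : ∀ z ∈ V, ∀ j, z j = 0 → p j = 0 := by
    intro z hz j hzj
    by_contra hpj
    have := (hV z hz j).2 hpj
    rw [hzj, norm_zero] at this
    exact this.not_ge (by positivity)
  have hsummable : Summable fun α => ∑ s, ‖a α * laurentMonomial α (signScale ρ s q)‖ :=
    summable_sum fun s _ => hs _ (hmem s)
  refine ((differentiableOn_tsum_of_norm_le hVo hsummable
    (φ := fun α z => a α * laurentMonomial α z) (fun α z hz => ?_)
    fun α z hz => ?_).differentiableAt (hVo.mem_nhds hpV)).differentiableWithinAt
  all_goals rcases eq_or_ne (a α) 0 with ha | ha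
  · simp only [ha, zero_mul]
    exact differentiableWithinAt_const 0
  · exact ((differentiableAt_laurentMonomial α fun j hj =>
      hpos p hp j (hzero z hz j hj) α ha).const_mul (a α)).differentiableWithinAt
  · simp only [ha, zero_mul, norm_zero, Finset.sum_const_zero, le_refl]
  · have hterm : ‖laurentMonomial α z‖ ≤
        ‖laurentMonomial α (signScale ρ (fun j => sign (α j)) q)‖ :=
      norm_laurentMonomial_le_signScale (by positivity) hq.2 (fun j => (hV z hz j).1.le)
        fun j hj => ((hV z hz j).2 fun hpj => hj.not_ge (hpos p hp j hpj α ha)).le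
    calc ‖a α * laurentMonomial α z‖
        ≤ ‖a α * laurentMonomial α (signScale ρ (fun j => sign (α j)) q)‖ := by
          rw [norm_mul, norm_mul]
          gcongr
      _ ≤ ∑ s, ‖a α * laurentMonomial α (signScale ρ s q)‖ :=
          Finset.single_le_sum (f := fun s => ‖a α * laurentMonomial α (signScale ρ s q)‖)
            (fun _ _ => norm_nonneg _) (Finset.mem_univ _)

theorem laurentMonomial_update {ι : Type*} [Fintype ι] [DecidableEq ι] (α : ι → ℤ) (z : ι → ℂ)
    (j : ι) (t : ℂ) : laurentMonomial α (Function.update z j t) =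
      t ^ α j * ∏ i ∈ Finset.univ.erase j, z i ^ α i := by
  rw [laurentMonomial, ← Finset.mul_prod_erase _ _ (Finset.mem_univ j), Function.update_self]
  congr 1
  exact Finset.prod_congr rfl fun i hi => by rw [Function.update_of_ne (Finset.ne_of_mem_erase hi)]

theorem laurentMonomial_update_mul {ι : Type*} [Fintype ι] [DecidableEq ι] (α : ι → ℤ) (z : ι → ℂ)
    (j : ι) (t : ℂ) :
    laurentMonomial α (Function.update z j (t * z j)) = t ^ α j * laurentMonomial α z := by
  rw [laurentMonomial_update, mul_zpow, mul_assoc, ← laurentMonomial_update,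
    Function.update_eq_self]

theorem nonneg_of_norm_laurentMonomial_le {ι : Type*} [Fintype ι] {U : Set (ι → ℂ)}
    (hU : IsOpen U) {z : ι → ℂ} (hz : z ∈ U) {j : ι} (hj : z j = 0) {β : ι → ℤ} {M : ℝ}
    (hM : ∀ w ∈ U ∩ nonvanishing ι, ‖laurentMonomial β w‖ ≤ M) : 0 ≤ β j := by
  classical
  by_contra! hβ
  obtain ⟨w, hwU, hw⟩ := dense_nonvanishing.inter_open_nonempty {w | Function.update w j 0 ∈ U}
    (hU.preimage (continuous_id.update j continuous_const))
    ⟨z, by rwa [mem_ofPred_eq, ← hj, Function.update_eq_self]⟩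
  have hmem : ∀ᶠ t : ℂ in 𝓝[≠] 0, Function.update w j (t * w j) ∈ U :=
    (((continuous_const.update j (by fun_prop)).continuousAt (x := (0 : ℂ))).eventually_mem
      (hU.mem_nhds (by rwa [zero_mul]))).filter_mono nhdsWithin_le_nhds
  have hbdd : ∀ᶠ t : ℂ in 𝓝[≠] 0, ‖t ^ β j‖ * ‖laurentMonomial β w‖ ≤ M := by
    filter_upwards [hmem, self_mem_nhdsWithin] with t htU ht
    rw [← norm_mul, ← laurentMonomial_update_mul]
    refine hM _ ⟨htU, fun i => ?_⟩
    rcases eq_or_ne i j with rfl | hij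
    · simpa using ⟨ht, hw i⟩
    · simpa [hij] using hw i
  have hpos : 0 < ‖laurentMonomial β w‖ :=
    norm_pos_iff.2 (Finset.prod_ne_zero_iff.2 fun i _ => zpow_ne_zero _ (hw i))
  have hblowup := (tendsto_norm_cobounded_atTop.comp
    (tendsto_zpow_nhdsNE_zero_cobounded (α := ℂ) hβ)).atTop_mul_const hpos
  obtain ⟨t, ht, htM⟩ := ((hblowup.eventually_gt_atTop M).and hbdd).exists
  exact htM.not_gt ht

end LaurentSeries

section LogImage

variable {ι : Type*}

/-- The vector `(log |z₁|, …, log |zₙ|)`. Since `Real.log 0 = 0`, it is meaningful only on the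
complex torus. -/
noncomputable def logAbs (z : ι → ℂ) : ι → ℝ := fun j => Real.log ‖z j‖

/-- The point `(e^{x₁}, …, e^{xₙ})`, which witnesses `x ∈ logSet G`. -/
noncomputable def expPoint (x : ι → ℝ) : ι → ℂ := fun j => (Real.exp (x j) : ℝ)

theorem expPoint_mem_nonvanishing (x : ι → ℝ) : expPoint x ∈ nonvanishing ι :=
  fun j => by simp [expPoint]

theorem norm_expPoint_apply (x : ι → ℝ) (j : ι) : ‖expPoint x j‖ = Real.exp (x j) := by
  rw [expPoint, Complex.norm_of_nonneg (Real.exp_pos _).le]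

theorem logAbs_expPoint (x : ι → ℝ) : logAbs (expPoint x) = x := by
  ext j
  rw [logAbs, norm_expPoint_apply, Real.log_exp]

theorem continuous_expPoint : Continuous (expPoint (ι := ι)) := by
  unfold expPoint
  fun_prop

theorem norm_expPoint_logAbs {z : ι → ℂ} (hz : z ∈ nonvanishing ι) (j : ι) :
    ‖expPoint (logAbs z) j‖ = ‖z j‖ := by
  rw [norm_expPoint_apply, logAbs, Real.exp_log (norm_pos_iff.2 (hz j))]

theorem logAbs_mul {z w : ι → ℂ} (hz : z ∈ nonvanishing ι) (hw : w ∈ nonvanishing ι) :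
    logAbs (z * w) = logAbs z + logAbs w := by
  ext j
  simp only [logAbs, Pi.mul_apply, Pi.add_apply, norm_mul]
  exact Real.log_mul (norm_ne_zero_iff.2 (hz j)) (norm_ne_zero_iff.2 (hw j))

theorem continuousOn_logAbs : ContinuousOn (logAbs (ι := ι)) (nonvanishing ι) :=
  continuousOn_pi.2 fun j => (continuous_apply j).norm.continuousOn.log fun _ hz =>
    norm_ne_zero_iff.2 (hz j)

theorem norm_laurentMonomial_eq_exp [Fintype ι] (α : ι → ℤ) {z : ι → ℂ}
    (hz : z ∈ nonvanishing ι) :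
    ‖laurentMonomial α z‖ = Real.exp (∑ j, (α j : ℝ) * logAbs z j) := by
  rw [norm_laurentMonomial, Real.exp_sum]
  refine Finset.prod_congr rfl fun j _ => ?_
  rw [logAbs, mul_comm, Real.exp_mul, Real.exp_log (norm_pos_iff.2 (hz j)), Real.rpow_intCast]

theorem nonvanishing_inter_logAbs_preimage_eq_image (X : Set (ι → ℝ)) :
    nonvanishing ι ∩ logAbs ⁻¹' X = (fun p : (ι → ℝ) × (ι → ℝ) => fun j =>
      Complex.exp (p.1 j + p.2 j * Complex.I)) '' (X ×ˢ univ) := by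
  ext z
  constructor
  · rintro ⟨hz, hzX⟩
    refine ⟨(logAbs z, fun j => (z j).arg), ⟨hzX, mem_univ _⟩, funext fun j => ?_⟩
    simp only [logAbs]
    rw [← Complex.log_re, ← Complex.log_im, Complex.re_add_im, Complex.exp_log (hz j)]
  · rintro ⟨⟨x, θ⟩, ⟨hx, -⟩, rfl⟩
    have hlog : logAbs (fun j => Complex.exp (x j + θ j * Complex.I)) = x := by
      ext j
      simp [logAbs, Complex.norm_exp]
    exact ⟨fun j => Complex.exp_ne_zero _, by rwa [mem_preimage, hlog]⟩

theorem isPreconnected_nonvanishing_inter_logAbs_preimage {X : Set (ι → ℝ)}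
    (hX : IsPreconnected X) : IsPreconnected (nonvanishing ι ∩ logAbs ⁻¹' X) := by
  rw [nonvanishing_inter_logAbs_preimage_eq_image]
  exact (hX.prod isPreconnected_univ).image _ (Continuous.continuousOn (by fun_prop))

variable {n : ℕ} {G : Set (Fin n → ℂ)}

theorem mem_logSet_iff {x : Fin n → ℝ} : x ∈ logSet G ↔ expPoint x ∈ G := Iff.rfl

theorem isOpen_logSet (hG : IsOpen G) : IsOpen (logSet G) :=
  hG.preimage continuous_expPoint

theorem IsNCircled.logAbs_mem_logSet_iff (hc : IsNCircled G) {z : Fin n → ℂ}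
    (hz : z ∈ nonvanishing (Fin n)) : logAbs z ∈ logSet G ↔ z ∈ G :=
  ⟨fun h => hc.mem_of_norm_eq (norm_expPoint_logAbs hz) h,
    fun h => hc.mem_of_norm_eq (fun j => (norm_expPoint_logAbs hz j).symm) h⟩

theorem IsNCircled.nonempty_logSet (hc : IsNCircled G) (hG : IsOpen G) (hne : G.Nonempty) :
    (logSet G).Nonempty := by
  obtain ⟨z, hzG, hz⟩ := dense_nonvanishing.inter_open_nonempty _ hG hne
  exact ⟨_, (hc.logAbs_mem_logSet_iff hz).2 hzG⟩

end LogImage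

section LogConvexity

variable {n : ℕ} {G : Set (Fin n → ℂ)}

theorem convex_setOf_summable_mul_exp {ι κ : Type*} [Fintype ι] {c : κ → ℝ} (hc : ∀ k, 0 ≤ c k)
    (l : κ → ι → ℝ) :
    Convex ℝ {x : ι → ℝ | Summable fun k => c k * Real.exp (∑ j, l k j * x j)} := by
  intro x hx y hy s t hs ht hst
  refine .of_nonneg_of_le (fun k => mul_nonneg (hc k) (Real.exp_pos _).le) (fun k => ?_)
    ((hx.mul_left s).add (hy.mul_left t))
  have hlin : ∑ j, l k j * (s • x + t • y) j = s • (∑ j, l k j * x j) + t • ∑ j, l k j * y j := by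
    simp only [Pi.add_apply, Pi.smul_apply, smul_eq_mul, Finset.mul_sum,
      ← Finset.sum_add_distrib]
    exact Finset.sum_congr rfl fun j _ => by ring
  calc c k * Real.exp (∑ j, l k j * (s • x + t • y) j)
      ≤ c k * (s • Real.exp (∑ j, l k j * x j) + t • Real.exp (∑ j, l k j * y j)) := by
        rw [hlin]
        exact mul_le_mul_of_nonneg_left
          (convexOn_exp.2 (mem_univ _) (mem_univ _) hs ht hst) (hc k)
    _ = s * (c k * Real.exp (∑ j, l k j * x j)) + t * (c k * Real.exp (∑ j, l k j * y j)) := by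
        simp only [smul_eq_mul]
        ring

theorem IsLaurentCoeff.summable_norm_of_logAbs_mem_convexHull {f : (Fin n → ℂ) → ℂ}
    {a : (Fin n → ℤ) → ℂ} (ha : IsLaurentCoeff f G a) (hG : IsOpen G) (hc : IsNCircled G)
    (hf : ContinuousOn f G) {z : Fin n → ℂ} (hz : z ∈ nonvanishing (Fin n))
    (hzX : logAbs z ∈ convexHull ℝ (logSet G)) :
    Summable fun α => ‖a α * laurentMonomial α z‖ := by
  have hnorm : ∀ w ∈ nonvanishing (Fin n), ∀ α, ‖a α * laurentMonomial α w‖ =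
      ‖a α‖ * Real.exp (∑ j, (α j : ℝ) * logAbs w j) := fun w hw α => by
    rw [norm_mul, norm_laurentMonomial_eq_exp α hw]
  have hsub : logSet G ⊆
      {x | Summable fun α => ‖a α‖ * Real.exp (∑ j, (α j : ℝ) * x j)} := by
    intro x hx
    have hx0 := expPoint_mem_nonvanishing x
    have hsum := ha.summable_norm hG hc hf ⟨mem_logSet_iff.1 hx, hx0⟩
    simpa only [hnorm _ hx0, logAbs_expPoint, mem_ofPred_eq] using hsum
  have hsum := convexHull_min hsub
    (convex_setOf_summable_mul_exp (fun α => norm_nonneg (a α)) fun α j => (α j : ℝ)) hzX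
  simpa only [hnorm z hz, mem_ofPred_eq] using hsum

-- The Laurent series of every `f ∈ 𝓞(G)` converges over the convex hull of `log G`.
theorem convex_logSet (hc : IsNCircled G) (hG : IsDomainOfHolomorphy G) : Convex ℝ (logSet G) := by
  obtain ⟨⟨hopen, hconn⟩, hmax⟩ := hG
  set X := logSet G
  set G₁ : Set (Fin n → ℂ) := nonvanishing (Fin n) ∩ logAbs ⁻¹' convexHull ℝ X
  have hG₀ : IsCDomain (G ∩ nonvanishing (Fin n)) :=
    ⟨hopen.inter isOpen_nonvanishing,
      dense_nonvanishing.inter_open_nonempty _ hopen hconn.nonempty,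
      isPreconnected_inter_nonvanishing hopen hconn.isPreconnected⟩
  have hG₀₁ : G ∩ nonvanishing (Fin n) ⊆ G₁ := fun z hz =>
    ⟨hz.2, subset_convexHull ℝ X ((hc.logAbs_mem_logSet_iff hz.2).2 hz.1)⟩
  have hG₁ : IsCDomain G₁ :=
    ⟨continuousOn_logAbs.isOpen_inter_preimage isOpen_nonvanishing (isOpen_logSet hopen).convexHull,
      hG₀.2.nonempty.mono hG₀₁,
      isPreconnected_nonvanishing_inter_logAbs_preimage (convex_convexHull ℝ X).isPreconnected⟩
  have hsub : G₁ ⊆ G := by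
    by_contra hns
    refine hmax ⟨_, G₁, hG₀, hG₁, subset_inter inter_subset_left hG₀₁, hns, fun f hf => ?_⟩
    obtain ⟨a, ha⟩ := hc.exists_isLaurentCoeff hopen hconn.isPreconnected hf
    refine ⟨fun z => ∑' α, a α * laurentMonomial α z, ?_, fun z hz =>
      (ha.hasSum hopen hc hf.continuousOn hz).tsum_eq⟩
    exact differentiableOn_tsum_laurent hG₁.1
      (fun z hz => ha.summable_norm_of_logAbs_mem_convexHull hopen hc hf.continuousOn hz.2 hz.1.2)
      fun p hp j hj => absurd hj (hp.1 j)
  have hhull : convexHull ℝ X ⊆ X := fun x hx => mem_logSet_iff.2 <|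
    hsub ⟨expPoint_mem_nonvanishing x, by rwa [mem_preimage, logAbs_expPoint]⟩
  exact convexHull_eq_self.1 (hhull.antisymm (subset_convexHull ℝ X))

theorem IsNCircled.logAbs_mem_closure_logSet (hc : IsNCircled G) {z : Fin n → ℂ}
    (hz : z ∈ nonvanishing (Fin n)) (hzG : z ∈ closure G) : logAbs z ∈ closure (logSet G) := by
  have hcont : ContinuousWithinAt logAbs (nonvanishing (Fin n) ∩ G) z :=
    (continuousOn_logAbs z hz).mono inter_subset_left
  exact hcont.mem_closure (isOpen_nonvanishing.inter_closure ⟨hz, hzG⟩) fun w hw =>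
    (hc.logAbs_mem_logSet_iff hw.1).2 hw.2

theorem IsNCircled.interior_closure_inter_nonvanishing_subset (hc : IsNCircled G) (hG : IsOpen G)
    (hconv : Convex ℝ (logSet G)) : interior (closure G) ∩ nonvanishing (Fin n) ⊆ G := by
  rintro z ⟨hz, hz0⟩
  have hX : IsOpen (logSet G) := isOpen_logSet hG
  have hXne : (logSet G).Nonempty :=
    hc.nonempty_logSet hG (closure_nonempty_iff.1 ⟨z, interior_subset hz⟩)
  let w : (Fin n → ℝ) → Fin n → ℂ := fun y => expPoint (y - logAbs z) * z
  have hw : Continuous w :=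
    (continuous_expPoint.comp (continuous_id.sub continuous_const)).mul continuous_const
  have hw0 : ∀ y, w y ∈ nonvanishing (Fin n) := fun y j =>
    mul_ne_zero (expPoint_mem_nonvanishing _ j) (hz0 j)
  have hlogw : ∀ y, logAbs (w y) = y := fun y => by
    rw [logAbs_mul (expPoint_mem_nonvanishing _) hz0, logAbs_expPoint, sub_add_cancel]
  have hwz : w (logAbs z) = z := by
    ext j
    simp [w, expPoint]
  have hmem : logAbs z ∈ interior (closure (logSet G)) := by
    refine mem_interior.2 ⟨w ⁻¹' interior (closure G), fun y hy => ?_, isOpen_interior.preimage hw,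
      by rwa [mem_preimage, hwz]⟩
    rw [← hlogw y]
    exact hc.logAbs_mem_closure_logSet (hw0 y) (interior_subset hy)
  rw [hconv.interior_closure_eq_interior_of_nonempty_interior (by rwa [hX.interior_eq]),
    hX.interior_eq] at hmem
  exact (hc.logAbs_mem_logSet_iff hz0).1 hmem

theorem IsLaurentCoeff.norm_mul_laurentMonomial_le {f : (Fin n → ℂ) → ℂ} {a : (Fin n → ℤ) → ℂ}
    (ha : IsLaurentCoeff f G a) (hc : IsNCircled G) {M : ℝ} (hM : ∀ z ∈ G, ‖f z‖ ≤ M)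
    (α : Fin n → ℤ) {z : Fin n → ℂ} (hz : z ∈ G ∩ nonvanishing (Fin n)) :
    ‖a α * laurentMonomial α z‖ ≤ M := by
  rw [← ha α z hz]
  exact norm_laurentCoeffFun_le α fun θ => hM _ (hc.torusPoint_mul_mem θ hz.1)

theorem IsNCircled.exists_extension_interior_closure (hc : IsNCircled G) (hG : IsOpen G)
    (hconn : IsPreconnected G) (hconv : Convex ℝ (logSet G)) {f : (Fin n → ℂ) → ℂ}
    (hf : DifferentiableOn ℂ f G) {M : ℝ} (hM : ∀ z ∈ G, ‖f z‖ ≤ M) :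
    ∃ g, DifferentiableOn ℂ g (interior (closure G)) ∧ EqOn g f (G ∩ nonvanishing (Fin n)) := by
  obtain ⟨a, ha⟩ := hc.exists_isLaurentCoeff hG hconn hf
  have hsub := hc.interior_closure_inter_nonvanishing_subset hG hconv
  refine ⟨fun z => ∑' α, a α * laurentMonomial α z, ?_, fun z hz =>
      (ha.hasSum hG hc hf.continuousOn hz).tsum_eq⟩
  refine differentiableOn_tsum_laurent isOpen_interior
    (fun z hz => ha.summable_norm hG hc hf.continuousOn ⟨hsub hz, hz.2⟩) ?_
  intro p hp j hj α hα
  refine nonneg_of_norm_laurentMonomial_le (M := M / ‖a α‖) isOpen_interior hp hj fun w hw => ?_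
  rw [le_div_iff₀' (norm_pos_iff.2 hα), ← norm_mul]
  exact ha.norm_mul_laurentMonomial_le hc hM α ⟨hsub hw, hw.2⟩

end LogConvexity

section BoundedFunctions

theorem exists_norm_le_of_memLp_top {X F : Type*} [TopologicalSpace X] [MeasurableSpace X]
    [NormedAddCommGroup F] {μ : Measure X} [μ.IsOpenPosMeasure] {U : Set X} (hU : IsOpen U)
    {g : X → F} (hg : ContinuousOn g U) (hLp : MemLp g ∞ (μ.restrict U)) :
    ∃ M : ℝ, ∀ z ∈ U, ‖g z‖ ≤ M := by
  set M := (eLpNormEssSup g (μ.restrict U)).toReal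
  have hfin : eLpNormEssSup g (μ.restrict U) ≠ ∞ := by
    rw [← eLpNorm_exponent_top]
    exact hLp.2.ne
  have hae : (fun z => max ‖g z‖ M) =ᵐ[μ.restrict U] fun _ => M := by
    filter_upwards [ae_le_eLpNormEssSup (f := g) (μ := μ.restrict U)] with z hz
    refine max_eq_right ?_
    rw [← toReal_enorm]
    exact ENNReal.toReal_mono hfin hz
  exact ⟨M, fun z hz => max_eq_right_iff.1 <|
    Measure.eqOn_open_of_ae_eq hae hU (hg.norm.sup continuousOn_const) continuousOn_const hz⟩

variable {n : ℕ} {G : Set (Fin n → ℂ)} {f : (Fin n → ℂ) → ℂ}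

theorem multiPartial_zero (f : (Fin n → ℂ) → ℂ) : multiPartial 0 f = f := by
  simp [multiPartial]

theorem multiPartial_single (j : Fin n) (f : (Fin n → ℂ) → ℂ) :
    multiPartial (Pi.single j 1) f = cpartial j f := by
  have hfold : ∀ l : List (Fin n), l.Nodup →
      l.foldr (fun i g => (cpartial i)^[(Pi.single j 1 : Fin n → ℕ) i] g) f =
        if j ∈ l then cpartial j f else f := by
    intro l hl
    induction l with
    | nil => rfl
    | cons i l ih =>
      obtain ⟨hil, hl⟩ := List.nodup_cons.1 hl
      rw [List.foldr_cons, ih hl]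
      rcases eq_or_ne i j with rfl | hij
      · simp [hil]
      · simp [hij, hij.symm]
  exact (hfold _ (List.nodup_finRange n)).trans (if_pos (List.mem_finRange j))

theorem exists_norm_le_of_mem_hInfty (hG : IsOpen G) {k : ℕ} (hf : f ∈ hInfty k G) :
    ∃ M : ℝ, ∀ z ∈ G, ‖f z‖ ≤ M := by
  have hLp := hf.2 0 (by simp)
  rw [multiPartial_zero] at hLp
  exact exists_norm_le_of_memLp_top hG (DifferentiableOn.continuousOn hf.1) hLp

theorem exists_norm_fderiv_le_of_mem_hInfty (hG : IsOpen G) {k : ℕ} (hk : 1 ≤ k)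
    (hf : f ∈ hInfty k G) (j : Fin n) :
    ∃ M : ℝ, ∀ z ∈ G, ‖fderiv ℂ f z (Pi.single j 1)‖ ≤ M := by
  have hLp := hf.2 (Pi.single j 1) (by simpa using hk)
  rw [multiPartial_single] at hLp
  exact exists_norm_le_of_memLp_top hG
    ((continuousOn_fderiv_of_differentiableOn hG hf.1).clm_apply continuousOn_const) hLp

theorem cpartial_laurentMonomial (α : Fin n → ℤ) (j : Fin n) {z : Fin n → ℂ}
    (hz : ∀ i, z i = 0 → 0 ≤ α i) :
    cpartial j (laurentMonomial α) z = (α j : ℂ) * laurentMonomial (α - Pi.single j 1) z := by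
  have hslice : HasDerivAt (fun t => laurentMonomial α (Function.update z j t))
      (cpartial j (laurentMonomial α) z) (z j) :=
    HasFDerivAt.comp_hasDerivAt (f := Function.update z j) (l := laurentMonomial α) (z j)
      (by
        rw [Function.update_eq_self]
        exact (differentiableAt_laurentMonomial α hz).hasFDerivAt)
      (hasDerivAt_update z j (z j))
  simp only [laurentMonomial_update] at hslice
  have hzpow := hasDerivAt_zpow (α j) (z j) (or_iff_not_imp_left.2 fun h => hz j (not_not.1 h))
  have hmonomial := laurentMonomial_update (α - Pi.single j 1) z j (z j)
  rw [Function.update_eq_self] at hmonomial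
  rw [hslice.unique (hzpow.mul_const _), mul_assoc, hmonomial, Pi.sub_apply, Pi.single_eq_same]
  congr 2
  exact Finset.prod_congr rfl fun i hi => by
    rw [Pi.sub_apply, Pi.single_eq_of_ne (Finset.ne_of_mem_erase hi), sub_zero]

theorem IsLaurentCoeff.norm_mul_laurentMonomial_sub_single_le {a : (Fin n → ℤ) → ℂ}
    (ha : IsLaurentCoeff f G a) (hc : IsNCircled G) (hG : IsOpen G) (hf : DifferentiableOn ℂ f G)
    {j : Fin n} {M : ℝ} (hM : ∀ z ∈ G, ‖fderiv ℂ f z (Pi.single j 1)‖ ≤ M) (α : Fin n → ℤ)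
    {z : Fin n → ℂ} (hz : z ∈ G ∩ nonvanishing (Fin n)) :
    ‖a α * α j * laurentMonomial (α - Pi.single j 1) z‖ ≤ M := by
  have hz0 : ∀ i, z i = 0 → 0 ≤ α i := fun i hi => absurd hi (hz.2 i)
  have heq : laurentCoeffFun f α =ᶠ[nhds z] fun z => a α * laurentMonomial α z :=
    Filter.eventuallyEq_of_mem ((hG.inter isOpen_nonvanishing).mem_nhds hz) (ha α)
  have hderiv : fderiv ℂ (laurentCoeffFun f α) z (Pi.single j 1) =
      a α * α j * laurentMonomial (α - Pi.single j 1) z := by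
    rw [heq.fderiv_eq, fderiv_const_mul (differentiableAt_laurentMonomial α hz0), mul_assoc,
      ← cpartial_laurentMonomial α j hz0]
    rfl
  rw [← hderiv]
  exact hc.norm_fderiv_laurentCoeffFun_single_le hG hf α hM hz.1

end BoundedFunctions

section Lineality

variable {n : ℕ} {X : Set (Fin n → ℝ)} {v x : Fin n → ℝ}

theorem add_smul_mem_of_mem_linealitySpace (hv : v ∈ linealitySpace X) (hx : x ∈ X) (s : ℝ) :
    x + s • v ∈ X := by
  have hadd : X + (linealitySpace X : Set (Fin n → ℝ)) = X := (linealitySpace_isGreatest X).1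
  rw [← hadd]
  exact add_mem_add hx ((linealitySpace X).smul_mem s hv)

theorem comap_linealitySpace_le {m : ℕ} (P : (Fin n → ℝ) →ₗ[ℝ] (Fin m → ℝ))
    (Y : Set (Fin m → ℝ)) : (linealitySpace Y).comap P ≤ linealitySpace (P ⁻¹' Y) := by
  refine (linealitySpace_isGreatest _).2 (Subset.antisymm ?_ fun x hx =>
    ⟨x, hx, 0, Submodule.zero_mem _, add_zero x⟩)
  rintro _ ⟨x, hx, v, hv, rfl⟩
  simpa using add_smul_mem_of_mem_linealitySpace hv hx 1

theorem sum_mul_eq_zero_of_mem_linealitySpace (hX : X.Nonempty) {l : Fin n → ℝ} {C : ℝ}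
    (hC : ∀ x ∈ X, ∑ i, l i * x i ≤ C) (hv : v ∈ linealitySpace X) : ∑ i, l i * v i = 0 := by
  obtain ⟨x, hx⟩ := hX
  by_contra hlv
  set s := (C - ∑ i, l i * x i + 1) / ∑ i, l i * v i with hs
  have hline : ∑ i, l i * (x + s • v) i = ∑ i, l i * x i + s * ∑ i, l i * v i := by
    rw [Finset.mul_sum, ← Finset.sum_add_distrib]
    exact Finset.sum_congr rfl fun i _ => by
      rw [Pi.add_apply, Pi.smul_apply, smul_eq_mul]
      ring
  have hle := hC _ (add_smul_mem_of_mem_linealitySpace hv hx s)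
  rw [hline, hs, div_mul_cancel₀ _ hlv] at hle
  linarith

variable {G : Set (Fin n → ℂ)} {f : (Fin n → ℂ) → ℂ}

theorem sum_mul_eq_zero_of_norm_laurentMonomial_le (hG : (logSet G).Nonempty) {β : Fin n → ℤ}
    {M : ℝ} (hM : ∀ z ∈ G ∩ nonvanishing (Fin n), ‖laurentMonomial β z‖ ≤ M)
    (hv : v ∈ linealitySpace (logSet G)) : ∑ i, (β i : ℝ) * v i = 0 := by
  refine sum_mul_eq_zero_of_mem_linealitySpace hG (C := M) (fun x hx => ?_) hv
  have hx0 := expPoint_mem_nonvanishing x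
  have hexp := hM _ ⟨mem_logSet_iff.1 hx, hx0⟩
  rw [norm_laurentMonomial_eq_exp β hx0, logAbs_expPoint] at hexp
  linarith [Real.add_one_le_exp (∑ i, (β i : ℝ) * x i)]

-- Along a line of `log G` both `a α * z ^ α` and its `j`-th derivative stay bounded, so both
-- exponents `α` and `α - eⱼ` are orthogonal to `v`.
theorem IsLaurentCoeff.apply_eq_zero_of_mem_hInfty {a : (Fin n → ℤ) → ℂ}
    (ha : IsLaurentCoeff f G a) (hc : IsNCircled G) (hG : IsOpen G) (hne : G.Nonempty) {k : ℕ}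
    (hk : 1 ≤ k) (hf : f ∈ hInfty k G) {α : Fin n → ℤ} (hα : a α ≠ 0) {j : Fin n}
    (hv : v ∈ linealitySpace (logSet G)) (hvj : v j ≠ 0) : α j = 0 := by
  by_contra hαj
  have hX := hc.nonempty_logSet hG hne
  obtain ⟨M, hM⟩ := exists_norm_le_of_mem_hInfty hG hf
  obtain ⟨M', hM'⟩ := exists_norm_fderiv_le_of_mem_hInfty hG hk hf j
  have hcj : a α * α j ≠ 0 := mul_ne_zero hα (Int.cast_ne_zero.2 hαj)
  have hsum : ∑ i, (α i : ℝ) * v i = 0 := by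
    refine sum_mul_eq_zero_of_norm_laurentMonomial_le hX (M := M / ‖a α‖) (fun z hz => ?_) hv
    rw [le_div_iff₀' (norm_pos_iff.2 hα), ← norm_mul]
    exact ha.norm_mul_laurentMonomial_le hc hM α hz
  have hsum' : ∑ i, (((α - Pi.single j 1 : Fin n → ℤ) i : ℤ) : ℝ) * v i = 0 := by
    refine sum_mul_eq_zero_of_norm_laurentMonomial_le hX (M := M' / ‖a α * α j‖)
      (fun z hz => ?_) hv
    rw [le_div_iff₀' (norm_pos_iff.2 hcj), ← norm_mul]
    exact ha.norm_mul_laurentMonomial_sub_single_le hc hG hf.1 hM' α hz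
  refine hvj ?_
  simpa [sub_mul, Finset.sum_sub_distrib, hsum, Pi.single_apply] using hsum'

open Filter Topology in
theorem eventually_add_const_mem_nonvanishing {ι : Type*} [Finite ι] (z : ι → ℂ) :
    ∀ᶠ t : ℂ in 𝓝[≠] 0, (z + fun _ => t) ∈ nonvanishing ι := by
  refine eventually_all.2 fun j => ?_
  filter_upwards [nhdsNE_le_cofinite 0 (finite_singleton (-z j)).compl_mem_cofinite] with t ht h
  exact ht (eq_neg_of_add_eq_zero_right h)

theorem eq_of_mem_hInfty_of_mem_nonvanishing (hc : IsNCircled G) (hG : IsOpen G)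
    (hconn : IsPreconnected G) {k : ℕ} (hk : 1 ≤ k) (hf : f ∈ hInfty k G) {z w : Fin n → ℂ}
    (hz : z ∈ G ∩ nonvanishing (Fin n)) (hw : w ∈ G ∩ nonvanishing (Fin n))
    (hzw : ∀ j, (∀ v ∈ linealitySpace (logSet G), v j = 0) → z j = w j) : f z = f w := by
  obtain ⟨a, ha⟩ := hc.exists_isLaurentCoeff hG hconn hf.1
  have hcont : ContinuousOn f G := DifferentiableOn.continuousOn hf.1
  rw [← (ha.hasSum hG hc hcont hz).tsum_eq, ← (ha.hasSum hG hc hcont hw).tsum_eq]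
  refine tsum_congr fun α => ?_
  rcases eq_or_ne (a α) 0 with hα | hα
  · rw [hα, zero_mul, zero_mul]
  congr 1
  refine Finset.prod_congr rfl fun j _ => ?_
  by_cases hj : ∀ v ∈ linealitySpace (logSet G), v j = 0
  · rw [hzw j hj]
  · push Not at hj
    obtain ⟨v, hv, hvj⟩ := hj
    rw [ha.apply_eq_zero_of_mem_hInfty hc hG ⟨z, hz.1⟩ hk hf hα hv hvj, zpow_zero, zpow_zero]

open Filter Topology in
theorem eq_of_mem_hInfty (hc : IsNCircled G) (hG : IsOpen G) (hconn : IsPreconnected G) {k : ℕ}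
    (hk : 1 ≤ k) (hf : f ∈ hInfty k G) {z w : Fin n → ℂ} (hz : z ∈ G) (hw : w ∈ G)
    (hzw : ∀ j, (∀ v ∈ linealitySpace (logSet G), v j = 0) → z j = w j) : f z = f w := by
  have hshift : ∀ u : Fin n → ℂ, Tendsto (fun t : ℂ => u + fun _ => t) (𝓝[≠] 0) (𝓝 u) := by
    intro u
    refine Tendsto.mono_left ?_ nhdsWithin_le_nhds
    exact Continuous.tendsto' (by fun_prop) 0 u (add_zero u)
  have hlim : ∀ u ∈ G, Tendsto (fun t : ℂ => f (u + fun _ => t)) (𝓝[≠] 0) (𝓝 (f u)) :=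
    fun u hu => ((DifferentiableOn.continuousOn hf.1).continuousAt
      (hG.mem_nhds hu)).tendsto.comp (hshift u)
  refine tendsto_nhds_unique (hlim z hz) ((hlim w hw).congr' ?_)
  filter_upwards [eventually_add_const_mem_nonvanishing z, eventually_add_const_mem_nonvanishing w,
    (hshift z).eventually_mem (hG.mem_nhds hz), (hshift w).eventually_mem (hG.mem_nhds hw)]
    with t hz0 hw0 hzG hwG
  refine (eq_of_mem_hInfty_of_mem_nonvanishing hc hG hconn hk hf ⟨hzG, hz0⟩ ⟨hwG, hw0⟩
    fun j hj => ?_).symm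
  rw [Pi.add_apply, Pi.add_apply, hzw j hj]

end Lineality

section CoordinateProjection

theorem isPreconnected_preimage_of_rightInverse {𝕜 E F : Type*} [NontriviallyNormedField 𝕜]
    [AddCommGroup E] [Module 𝕜 E] [TopologicalSpace E] [IsTopologicalAddGroup E]
    [AddCommGroup F] [Module 𝕜 F] [TopologicalSpace F] [IsTopologicalAddGroup F]
    [PreconnectedSpace E] {P : E →L[𝕜] F} {R : F →L[𝕜] E} (hPR : ∀ u, P (R u) = u) {D : Set F}
    (hD : IsPreconnected D) : IsPreconnected (P ⁻¹' D) := by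
  have himage : P ⁻¹' D = (fun p : F × E => p.2 + R (p.1 - P p.2)) '' (D ×ˢ univ) := by
    ext z
    constructor
    · exact fun hz => ⟨(P z, z), ⟨hz, mem_univ _⟩, by simp⟩
    · rintro ⟨⟨u, w⟩, ⟨hu, -⟩, rfl⟩
      rwa [mem_preimage, map_add, hPR, add_sub_cancel]
  rw [himage]
  exact (hD.prod isPreconnected_univ).image _ (Continuous.continuousOn (by fun_prop))

theorem exists_differentiableOn_image {𝕜 E F H : Type*} [NontriviallyNormedField 𝕜]
    [NormedAddCommGroup E] [NormedSpace 𝕜 E] [NormedAddCommGroup F] [NormedSpace 𝕜 F]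
    [NormedAddCommGroup H] [NormedSpace 𝕜 H] {P : E →L[𝕜] F} {R : F →L[𝕜] E}
    (hPR : ∀ u, P (R u) = u) {G : Set E} (hG : IsOpen G) {f : E → H}
    (hf : DifferentiableOn 𝕜 f G) (hfib : ∀ z ∈ G, ∀ w ∈ G, P z = P w → f z = f w) :
    ∃ h : F → H, DifferentiableOn 𝕜 h (P '' G) ∧ ∀ z ∈ G, h (P z) = f z := by
  have hfactor : Function.FactorsThrough (G.domRestrict f) (G.domRestrict P) :=
    fun z w hzw => hfib z z.2 w w.2 hzw
  set h : F → H := Function.extend (G.domRestrict P) (G.domRestrict f) 0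
  have hP : ∀ z ∈ G, h (P z) = f z := fun z hz => hfactor.extend_apply 0 ⟨z, hz⟩
  refine ⟨h, ?_, hP⟩
  rintro _ ⟨w, hw, rfl⟩
  have hcont : ContinuousAt (fun u => w + R (u - P w)) (P w) := by fun_prop
  have hbase : w + R (P w - P w) = w := by simp
  have hlocal : h =ᶠ[nhds (P w)] fun u => f (w + R (u - P w)) := by
    filter_upwards [hcont.eventually_mem (hG.mem_nhds (hbase.symm ▸ hw))] with u hu
    rw [← hP _ hu, map_add, hPR, add_sub_cancel]
  have hdiff : DifferentiableAt 𝕜 (fun u => f (w + R (u - P w))) (P w) :=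
    DifferentiableAt.comp (P w) (by
      rw [hbase]
      exact hf.differentiableAt (hG.mem_nhds hw)) (by fun_prop)
  exact (hdiff.congr_of_eventuallyEq hlocal).differentiableWithinAt

variable {m n : ℕ} {s : Fin m → Fin n}

/-- The projection `z ↦ z ∘ s` of `ℂⁿ` to the coordinates listed by `s`. -/
noncomputable def coordProj (s : Fin m → Fin n) : (Fin n → ℂ) →L[ℂ] (Fin m → ℂ) :=
  ContinuousLinearMap.pi fun i => ContinuousLinearMap.proj (s i)

/-- The inclusion of `ℂᵐ` in `ℂⁿ` with the coordinates listed by `s`, by extension by zero; a right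
inverse of `coordProj s` when `s` is injective. -/
noncomputable def coordIncl (s : Fin m → Fin n) : (Fin m → ℂ) →L[ℂ] (Fin n → ℂ) :=
  LinearMap.toContinuousLinearMap (Function.ExtendByZero.linearMap ℂ s)

theorem coordProj_apply (s : Fin m → Fin n) (z : Fin n → ℂ) (i : Fin m) :
    coordProj s z i = z (s i) := rfl

theorem coordProj_coordIncl (hs : Function.Injective s) (u : Fin m → ℂ) :
    coordProj s (coordIncl s u) = u :=
  funext fun i => hs.extend_apply u 0 i

theorem surjective_coordProj (hs : Function.Injective s) : Function.Surjective (coordProj s) :=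
  fun u => ⟨_, coordProj_coordIncl hs u⟩

theorem isOpenMap_coordProj (hs : Function.Injective s) : IsOpenMap (coordProj s) :=
  (coordProj s).isOpenMap (surjective_coordProj hs)

theorem IsCDomain.coordProj_preimage (hs : Function.Injective s) {D : Set (Fin m → ℂ)}
    (hD : IsCDomain D) : IsCDomain (coordProj s ⁻¹' D) :=
  ⟨hD.1.preimage (coordProj s).continuous, hD.2.nonempty.preimage (surjective_coordProj hs),
    isPreconnected_preimage_of_rightInverse (coordProj_coordIncl hs) hD.2.isPreconnected⟩

theorem IsCDomain.coordProj_image (hs : Function.Injective s) {G : Set (Fin n → ℂ)}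
    (hG : IsCDomain G) : IsCDomain (coordProj s '' G) :=
  ⟨isOpenMap_coordProj hs _ hG.1, hG.2.image _ (coordProj s).continuous.continuousOn⟩

theorem coordProj_preimage_interior_closure (hs : Function.Injective s) (D : Set (Fin m → ℂ)) :
    coordProj s ⁻¹' interior (closure D) = interior (closure (coordProj s ⁻¹' D)) := by
  rw [(isOpenMap_coordProj hs).preimage_interior_eq_interior_preimage (coordProj s).continuous,
    (isOpenMap_coordProj hs).preimage_closure_eq_closure_preimage (coordProj s).continuous]

theorem isFat_coordProj_preimage_iff (hs : Function.Injective s) {D : Set (Fin m → ℂ)} :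
    IsFat (coordProj s ⁻¹' D) ↔ IsFat D := by
  rw [IsFat, IsFat, ← coordProj_preimage_interior_closure hs,
    (surjective_coordProj hs).preimage_injective.eq_iff]

theorem IsNCircled.coordProj_image (hs : Function.Injective s) {G : Set (Fin n → ℂ)}
    (hG : IsNCircled G) : IsNCircled (coordProj s '' G) := by
  rintro _ ⟨z, hz, rfl⟩ θ
  refine ⟨_, hG z hz (Function.extend s θ 0), funext fun i => ?_⟩
  rw [coordProj_apply, coordProj_apply, hs.extend_apply]

theorem IsDomainOfHolomorphyFor.mono {𝓕 𝓖 : Set ((Fin n → ℂ) → ℂ)} {G : Set (Fin n → ℂ)}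
    (hG : IsDomainOfHolomorphyFor 𝓕 G) (h : 𝓕 ⊆ 𝓖) : IsDomainOfHolomorphyFor 𝓖 G :=
  ⟨hG.1, fun ⟨G₀, G₁, hG₀, hG₁, hsub, hns, hext⟩ =>
    hG.2 ⟨G₀, G₁, hG₀, hG₁, hsub, hns, fun f hf => hext f (h hf)⟩⟩

theorem exists_perm_range_castLE (J : Finset (Fin n)) (hJ : J.card ≤ n) :
    ∃ σ : Equiv.Perm (Fin n), range (fun i : Fin J.card => σ (Fin.castLE hJ i)) = J := by
  have hcard : Fintype.card {i : Fin n // (i : ℕ) < J.card} = Fintype.card {i // i ∈ J} := by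
    rw [Fintype.card_coe, Fintype.card_congr (Fin.castLEquiv hJ).symm, Fintype.card_fin]
  let e := Fintype.equivOfCardEq hcard
  refine ⟨e.extendSubtype, Subset.antisymm ?_ fun j hj => ?_⟩
  · rintro _ ⟨i, rfl⟩
    exact e.extendSubtype_mem _ i.2
  · refine ⟨⟨_, (e.symm ⟨j, hj⟩).2⟩, (e.extendSubtype_apply_of_mem _ (e.symm ⟨j, hj⟩).2).trans ?_⟩
    rw [Subtype.coe_eta, e.apply_symm_apply]

end CoordinateProjection

section Cylinder

variable {m n k : ℕ} {G : Set (Fin n → ℂ)} {s : Fin m → Fin n}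

theorem IsDomainOfHolomorphyFor.isFat_of_hInfty (hG : IsDomainOfHolomorphyFor (hInfty k G) G)
    (hc : IsNCircled G) (hconv : Convex ℝ (logSet G)) : IsFat G := by
  obtain ⟨⟨hopen, hconn⟩, hmax⟩ := hG
  have hsub : G ⊆ interior (closure G) := interior_maximal subset_closure hopen
  refine hsub.antisymm ?_
  by_contra hns
  refine hmax ⟨G ∩ nonvanishing (Fin n), interior (closure G),
    ⟨hopen.inter isOpen_nonvanishing,
      dense_nonvanishing.inter_open_nonempty _ hopen hconn.nonempty,
      isPreconnected_inter_nonvanishing hopen hconn.isPreconnected⟩,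
    ⟨isOpen_interior, hconn.nonempty.mono hsub,
      hconn.isPreconnected.subset_closure hsub interior_subset⟩,
    fun z hz => ⟨hz.1, hsub hz.1⟩, hns, fun f hf => ?_⟩
  obtain ⟨M, hM⟩ := exists_norm_le_of_mem_hInfty hopen hf
  exact hc.exists_extension_interior_closure hopen hconn.isPreconnected hconv hf.1 hM

theorem exists_holo_coordProj_image (hs : Function.Injective s) (hG : IsCDomain G)
    (hc : IsNCircled G) (hk : 1 ≤ k)
    (hrange : ∀ j, (∀ v ∈ linealitySpace (logSet G), v j = 0) → j ∈ range s)
    {f : (Fin n → ℂ) → ℂ} (hf : f ∈ hInfty k G) :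
    ∃ h ∈ holo (coordProj s '' G), ∀ z ∈ G, h (coordProj s z) = f z := by
  refine exists_differentiableOn_image (coordProj_coordIncl hs) hG.1 hf.1 fun z hz w hw hzw => ?_
  refine eq_of_mem_hInfty hc hG.1 hG.2.isPreconnected hk hf hz hw fun j hj => ?_
  obtain ⟨i, rfl⟩ := hrange j hj
  exact congr_fun hzw i

theorem IsDomainOfHolomorphyFor.eq_coordProj_preimage_image (hs : Function.Injective s)
    (hG : IsDomainOfHolomorphyFor (hInfty k G) G) (hc : IsNCircled G) (hk : 1 ≤ k)
    (hrange : ∀ j, (∀ v ∈ linealitySpace (logSet G), v j = 0) → j ∈ range s) :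
    G = coordProj s ⁻¹' (coordProj s '' G) := by
  have hsub : G ⊆ coordProj s ⁻¹' (coordProj s '' G) := subset_preimage_image _ _
  refine hsub.antisymm ?_
  by_contra hns
  refine hG.2 ⟨G, _, hG.1, (hG.1.coordProj_image hs).coordProj_preimage hs,
    subset_inter Subset.rfl hsub, hns, fun f hf => ?_⟩
  obtain ⟨h, hh, hhf⟩ := exists_holo_coordProj_image hs hG.1 hc hk hrange hf
  exact ⟨h ∘ coordProj s, DifferentiableOn.comp hh (coordProj s).differentiable.differentiableOn
    fun z hz => hz, hhf⟩

theorem IsDomainOfHolomorphyFor.coordProj_image (hs : Function.Injective s)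
    (hG : IsDomainOfHolomorphyFor (hInfty k G) G) (hc : IsNCircled G) (hk : 1 ≤ k)
    (hrange : ∀ j, (∀ v ∈ linealitySpace (logSet G), v j = 0) → j ∈ range s) :
    IsDomainOfHolomorphy (coordProj s '' G) := by
  have hcyl := hG.eq_coordProj_preimage_image hs hc hk hrange
  refine ⟨hG.1.coordProj_image hs, ?_⟩
  rintro ⟨D₀, D₁, hD₀, hD₁, hsub, hns, hext⟩
  have hsubG : coordProj s ⁻¹' D₀ ⊆ G := by
    rw [hcyl]
    exact preimage_mono (hsub.trans inter_subset_left)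
  refine hG.2 ⟨coordProj s ⁻¹' D₀, coordProj s ⁻¹' D₁, hD₀.coordProj_preimage hs,
    hD₁.coordProj_preimage hs, subset_inter hsubG (preimage_mono (hsub.trans inter_subset_right)),
    ?_, fun f hf => ?_⟩
  · rwa [hcyl, (surjective_coordProj hs).preimage_subset_preimage_iff]
  · obtain ⟨h, hh, hhf⟩ := exists_holo_coordProj_image hs hG.1 hc hk hrange hf
    obtain ⟨g, hg, hgh⟩ := hext h hh
    exact ⟨g ∘ coordProj s, DifferentiableOn.comp hg
      (coordProj s).differentiable.differentiableOn fun z hz => hz,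
      fun z hz => (hgh hz).trans (hhf z (hsubG hz))⟩

theorem linealitySpace_logSet_eq_bot (hs : Function.Injective s) {D : Set (Fin m → ℂ)}
    (hvanish : ∀ i, ∀ v ∈ linealitySpace (logSet (coordProj s ⁻¹' D)), v (s i) = 0) :
    linealitySpace (logSet D) = ⊥ := by
  refine (Submodule.eq_bot_iff _).2 fun u hu => funext fun i => ?_
  have hext : LinearMap.funLeft ℝ ℝ s (Function.extend s u 0) = u :=
    funext fun i => hs.extend_apply u 0 i
  have hmem : Function.extend s u 0 ∈ linealitySpace (logSet (coordProj s ⁻¹' D)) :=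
    comap_linealitySpace_le (LinearMap.funLeft ℝ ℝ s) (logSet D)
      (by rwa [Submodule.mem_comap, hext])
  exact (hs.extend_apply u 0 i).symm.trans (hvanish i _ hmem)

theorem IsDomainOfHolomorphyFor.isFatPointedTimesAffine
    (hG : IsDomainOfHolomorphyFor (hInfty k G) G) (hc : IsNCircled G) (hk : 1 ≤ k) :
    IsFatPointedTimesAffine G := by
  classical
  have hconv : Convex ℝ (logSet G) := convex_logSet hc (hG.mono fun f hf => hf.1)
  let J : Finset (Fin n) := {j | ∀ v ∈ linealitySpace (logSet G), v j = 0}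
  have hJ : J.card ≤ n := by simpa using J.card_le_univ
  obtain ⟨σ, hσ⟩ := exists_perm_range_castLE J hJ
  let s : Fin J.card → Fin n := fun i => σ (Fin.castLE hJ i)
  have hs : Function.Injective s := σ.injective.comp (Fin.castLE_injective hJ)
  have hrange : ∀ j, j ∈ range s ↔ ∀ v ∈ linealitySpace (logSet G), v j = 0 := fun j => by
    rw [hσ, Finset.mem_coe, Finset.mem_filter_univ]
  have hrange' := fun j => (hrange j).2
  have hcyl := hG.eq_coordProj_preimage_image hs hc hk hrange'
  refine ⟨J.card, hJ, σ, coordProj s '' G, ?_, hc.coordProj_image hs,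
    hG.coordProj_image hs hc hk hrange', ?_, hcyl⟩
  · rw [← isFat_coordProj_preimage_iff hs, ← hcyl]
    exact hG.isFat_of_hInfty hc hconv
  · refine linealitySpace_logSet_eq_bot hs fun i => ?_
    rw [← hcyl]
    exact (hrange (s i)).1 ⟨i, rfl⟩

end Cylinder

section DecayingExponent

variable {ι : Type*} [Fintype ι] {β : ι → ℤ} {X : Set (ι → ℝ)} {C r : ℝ}

/-- The exponent `β` of a Laurent monomial decays at rate `r` along `X`: `β · x ≤ C - r ‖x‖` on `X`.
On the points `z` with `logAbs z ∈ X` this is the bound `|z^β| ≤ e^C e^{-r ‖logAbs z‖}`. -/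
def DecaysOn (β : ι → ℤ) (X : Set (ι → ℝ)) (C r : ℝ) : Prop :=
  ∀ x ∈ X, ∑ j, (β j : ℝ) * x j ≤ C - r * ‖x‖

theorem DecaysOn.mono (hβ : DecaysOn β X C r) {s : ℝ} (hs : s ≤ r) : DecaysOn β X C s :=
  fun x hx => (hβ x hx).trans (by gcongr)

theorem DecaysOn.sub_single [DecidableEq ι] (hβ : DecaysOn β X C (r + 1)) (j : ι) :
    DecaysOn (β - Pi.single j 1) X C r := by
  intro x hx
  have hsum :
      ∑ i, (((β - Pi.single j 1 : ι → ℤ) i : ℤ) : ℝ) * x i = ∑ i, (β i : ℝ) * x i - x j := by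
    simp [sub_mul, Finset.sum_sub_distrib, Pi.single_apply]
  rw [hsum]
  linarith [hβ x hx, neg_le_of_abs_le (norm_le_pi_norm x j)]

end DecayingExponent

section LineFreeConvex

variable {E : Type*} [AddCommGroup E] [Module ℝ E] {X : Set E}

theorem add_mem_of_forall_bddAbove [TopologicalSpace E] [IsTopologicalAddGroup E]
    [ContinuousSMul ℝ E] (hX : IsOpen X) (hconv : Convex ℝ X) {v : E}
    (hv : ∀ l : Module.Dual ℝ E, BddAbove (l '' X) → l v = 0) {x : E} (hx : x ∈ X) :
    x + v ∈ X := by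
  by_contra hxv
  obtain ⟨g, hg⟩ := geometric_hahn_banach_open_point hconv hX hxv
  have hgv : g v = 0 := hv g ⟨g (x + v), forall_mem_image.2 fun y hy => (hg y hy).le⟩
  have hlt := hg x hx
  rw [map_add, hgv, add_zero] at hlt
  exact lt_irrefl _ hlt

theorem exists_abs_le_sub_of_mem_span_bddAbove {l : Module.Dual ℝ E}
    (hl : l ∈ Submodule.span ℝ {l : Module.Dual ℝ E | BddAbove (l '' X)}) :
    ∃ (γ : Module.Dual ℝ E) (C : ℝ), ∀ x ∈ X, |l x| ≤ C - γ x := by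
  induction hl using Submodule.span_induction with
  | mem l hl =>
    obtain ⟨c, hc⟩ := hl
    refine ⟨l, 2 * |c|, fun x hx => abs_le'.2 ?_⟩
    have hlx : l x ≤ |c| := (hc (mem_image_of_mem l hx)).trans (le_abs_self c)
    constructor <;> linarith [abs_nonneg c]
  | zero => exact ⟨0, 0, fun x _ => by simp⟩
  | add l₁ l₂ _ _ h₁ h₂ =>
    obtain ⟨γ₁, C₁, h₁⟩ := h₁
    obtain ⟨γ₂, C₂, h₂⟩ := h₂
    refine ⟨γ₁ + γ₂, C₁ + C₂, fun x hx => ?_⟩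
    rw [LinearMap.add_apply, LinearMap.add_apply]
    linarith [abs_add_le (l₁ x) (l₂ x), h₁ x hx, h₂ x hx]
  | smul c l _ h =>
    obtain ⟨γ, C, h⟩ := h
    refine ⟨|c| • γ, |c| * C, fun x hx => ?_⟩
    rw [LinearMap.smul_apply, LinearMap.smul_apply, smul_eq_mul, smul_eq_mul, abs_mul, ← mul_sub]
    exact mul_le_mul_of_nonneg_left (h x hx) (abs_nonneg c)

theorem span_bddAbove_eq_top_of_linealitySpace_eq_bot {m : ℕ} {X : Set (Fin m → ℝ)}
    (hX : IsOpen X) (hconv : Convex ℝ X) (hlin : linealitySpace X = ⊥) :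
    Submodule.span ℝ {l : Module.Dual ℝ (Fin m → ℝ) | BddAbove (l '' X)} = ⊤ := by
  set W := Submodule.span ℝ {l : Module.Dual ℝ (Fin m → ℝ) | BddAbove (l '' X)}
  have hW : W.dualCoannihilator ≤ linealitySpace X := by
    refine (linealitySpace_isGreatest X).2 (Subset.antisymm ?_ fun x hx =>
      ⟨x, hx, 0, Submodule.zero_mem _, add_zero x⟩)
    rintro _ ⟨x, hx, v, hv, rfl⟩
    exact add_mem_of_forall_bddAbove hX hconv
      (fun l hl => (Submodule.mem_dualCoannihilator v).1 hv l (Submodule.subset_span hl)) hx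
  rw [hlin, le_bot_iff] at hW
  rw [← Subspace.dualCoannihilator_dualAnnihilator_eq (W := W), hW, Submodule.dualAnnihilator_bot]

theorem exists_dual_le_sub_norm {m : ℕ} {X : Set (Fin m → ℝ)} (hX : IsOpen X)
    (hconv : Convex ℝ X) (hlin : linealitySpace X = ⊥) :
    ∃ (γ : Module.Dual ℝ (Fin m → ℝ)) (C : ℝ), ∀ x ∈ X, γ x ≤ C - ‖x‖ := by
  have hspan := span_bddAbove_eq_top_of_linealitySpace_eq_bot hX hconv hlin
  choose γ C h using fun j : Fin m =>
    exists_abs_le_sub_of_mem_span_bddAbove (l := LinearMap.proj j) (hspan ▸ Submodule.mem_top)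
  refine ⟨∑ j, γ j, ∑ j, C j, fun x hx => ?_⟩
  have hnorm : ‖x‖ ≤ ∑ j, |x j| :=
    (pi_norm_le_iff_of_nonneg (Finset.sum_nonneg fun _ _ => abs_nonneg _)).2 fun j =>
      Finset.single_le_sum (f := fun j => |x j|) (fun _ _ => abs_nonneg _) (Finset.mem_univ j)
  have hsum : ∑ j, |x j| ≤ ∑ j, (C j - γ j x) := Finset.sum_le_sum fun j _ => h j x hx
  rw [Finset.sum_sub_distrib] at hsum
  rw [LinearMap.sum_apply]
  linarith

theorem exists_int_abs_sum_mul_sub_le {ι : Type*} [Fintype ι] (l : Module.Dual ℝ (ι → ℝ)) :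
    ∃ α : ι → ℤ, ∀ x, |∑ j, (α j : ℝ) * x j - l x| ≤ Fintype.card ι * ‖x‖ := by
  classical
  let b : ι → ℝ := (dotProductEquiv ℝ ι).symm l
  have hb : ∀ x, l x = ∑ j, b j * x j := fun x =>
    (LinearMap.congr_fun ((dotProductEquiv ℝ ι).apply_symm_apply l) x).symm
  refine ⟨fun j => round (b j), fun x => ?_⟩
  calc |∑ j, (round (b j) : ℝ) * x j - l x|
      = |∑ j, (round (b j) - b j) * x j| := by
        rw [hb, ← Finset.sum_sub_distrib]
        simp only [sub_mul]
    _ ≤ ∑ j, |(round (b j) - b j) * x j| := Finset.abs_sum_le_sum_abs _ _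
    _ ≤ ∑ _j : ι, ‖x‖ := Finset.sum_le_sum fun j _ => by
        rw [abs_mul, abs_sub_comm]
        have hround : |b j - round (b j)| ≤ 1 := (abs_sub_round (b j)).trans (by norm_num)
        exact (mul_le_of_le_one_left (abs_nonneg _) hround).trans (norm_le_pi_norm x j)
    _ = Fintype.card ι * ‖x‖ := by simp

theorem exists_int_separating {m : ℕ} {X : Set (Fin m → ℝ)} (hX : IsOpen X)
    (hconv : Convex ℝ X) (hlin : linealitySpace X = ⊥) {q : Fin m → ℝ}
    (hq : q ∉ closure X) (r : ℝ) : ∃ (α : Fin m → ℤ) (C : ℝ),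
      DecaysOn α X C r ∧ C < ∑ j, (α j : ℝ) * q j := by
  obtain ⟨γ, C₀, hγ⟩ := exists_dual_le_sub_norm hX hconv hlin
  obtain ⟨f, u, hfu, huq⟩ := geometric_hahn_banach_closed_point hconv.closure isClosed_closure hq
  let s : ℝ := m + |r|
  obtain ⟨N, hN⟩ := exists_nat_gt ((s * C₀ - s * γ q + m * ‖q‖) / (f q - u))
  rw [div_lt_iff₀ (sub_pos.2 huq)] at hN
  obtain ⟨α, hα⟩ := exists_int_abs_sum_mul_sub_le ((N : ℝ) • (f : Module.Dual ℝ _) + s • γ)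
  simp only [LinearMap.add_apply, LinearMap.smul_apply, smul_eq_mul, Fintype.card_fin,
    ContinuousLinearMap.coe_coe] at hα
  refine ⟨α, N * u + s * C₀, fun x hx => ?_, ?_⟩
  · have hf : N * f x ≤ N * u := by gcongr; exact (hfu x (subset_closure hx)).le
    have hs : s * γ x ≤ s * (C₀ - ‖x‖) := by gcongr; exact hγ x hx
    have hr : r * ‖x‖ ≤ |r| * ‖x‖ := by gcongr; exact le_abs_self r
    linarith [(abs_le.1 (hα x)).2, show s * ‖x‖ = m * ‖x‖ + |r| * ‖x‖ from add_mul _ _ _]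
  · linarith [(abs_le.1 (hα q)).1]

end LineFreeConvex

section CoordinateDerivatives

variable {n : ℕ} {G : Set (Fin n → ℂ)} {f g : (Fin n → ℂ) → ℂ} {z : Fin n → ℂ}

theorem cpartial_eqOn (hG : IsOpen G) (h : EqOn f g G) (j : Fin n) :
    EqOn (cpartial j f) (cpartial j g) G := fun z hz => by
  rw [cpartial, cpartial, (Filter.eventuallyEq_of_mem (hG.mem_nhds hz) h).fderiv_eq]

theorem cpartial_const (c : ℂ) (j : Fin n) : cpartial j (fun _ => c) = fun _ => 0 := by
  ext z
  simp [cpartial]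

theorem cpartial_add (hf : DifferentiableAt ℂ f z) (hg : DifferentiableAt ℂ g z) (j : Fin n) :
    cpartial j (fun w => f w + g w) z = cpartial j f z + cpartial j g z := by
  rw [cpartial, fderiv_fun_add hf hg]
  rfl

theorem cpartial_mul (hf : DifferentiableAt ℂ f z) (hg : DifferentiableAt ℂ g z) (j : Fin n) :
    cpartial j (fun w => f w * g w) z = f z * cpartial j g z + g z * cpartial j f z := by
  rw [cpartial, fderiv_fun_mul hf hg]
  rfl

theorem cpartial_inv (hf : DifferentiableAt ℂ f z) (hz : f z ≠ 0) (j : Fin n) :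
    cpartial j (fun w => (f w)⁻¹) z = -1 * ((f z)⁻¹ * (f z)⁻¹ * cpartial j f z) := by
  have h := (hasDerivAt_inv hz).comp_hasFDerivAt z hf.hasFDerivAt
  rw [cpartial, HasFDerivAt.fderiv (f := fun w => (f w)⁻¹) h, cpartial,
    smul_apply, smul_eq_mul, sq, mul_inv]
  ring

theorem cpartial_comp_coordProj {m : ℕ} {s : Fin m → Fin n} {f : (Fin m → ℂ) → ℂ}
    (hf : DifferentiableAt ℂ f (coordProj s z)) (j : Fin n) :
    cpartial j (fun w => f (coordProj s w)) z =
      ∑ i, coordProj s (Pi.single j 1) i * cpartial i f (coordProj s z) := by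
  have h := hf.hasFDerivAt.comp z (coordProj s).hasFDerivAt
  rw [cpartial, HasFDerivAt.fderiv (f := fun w => f (coordProj s w)) h,
    ContinuousLinearMap.comp_apply]
  conv_lhs => rw [pi_eq_sum_univ' (coordProj s (Pi.single j 1)), map_sum]
  simp only [map_smul, smul_eq_mul, cpartial]

end CoordinateDerivatives

/-- `f` is holomorphic and bounded on `G` and extends continuously to the closure of `G`. -/
structure IsBoundedExtendable {n : ℕ} (G : Set (Fin n → ℂ)) (f : (Fin n → ℂ) → ℂ) : Prop where
  differentiableOn : DifferentiableOn ℂ f G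
  exists_bound : ∃ M : ℝ, ∀ z ∈ G, ‖f z‖ ≤ M
  exists_extension : ∃ g, ContinuousOn g (closure G) ∧ EqOn g f G

/-- All derivatives of `f` of order at most `k` are holomorphic, bounded and continuously extendable
to the closure of `G`. This recursive form of membership in `hInfty k G ∩ aSpace k G` is suited to
proving closure under products, inverses and composition. -/
def IsBoundedExtendableUpTo {n : ℕ} (G : Set (Fin n → ℂ)) : ℕ → ((Fin n → ℂ) → ℂ) → Prop
  | 0, f => IsBoundedExtendable G f
  | k + 1, f => IsBoundedExtendable G f ∧ ∀ j, IsBoundedExtendableUpTo G k (cpartial j f)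

namespace IsBoundedExtendable

variable {n : ℕ} {G : Set (Fin n → ℂ)} {f g : (Fin n → ℂ) → ℂ}

theorem differentiableAt (hf : IsBoundedExtendable G f) (hG : IsOpen G) {z : Fin n → ℂ}
    (hz : z ∈ G) : DifferentiableAt ℂ f z :=
  hf.differentiableOn.differentiableAt (hG.mem_nhds hz)

theorem congr (hf : IsBoundedExtendable G f) (h : EqOn g f G) : IsBoundedExtendable G g := by
  obtain ⟨hfd, ⟨M, hM⟩, e, he, hef⟩ := hf
  exact ⟨hfd.congr h, ⟨M, fun z hz => (h hz).symm ▸ hM z hz⟩, e, he, hef.trans h.symm⟩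

theorem const (G : Set (Fin n → ℂ)) (c : ℂ) : IsBoundedExtendable G fun _ => c :=
  ⟨differentiableOn_const c, ⟨‖c‖, fun _ _ => le_rfl⟩, fun _ => c, continuousOn_const,
    fun _ _ => rfl⟩

theorem add (hf : IsBoundedExtendable G f) (hg : IsBoundedExtendable G g) :
    IsBoundedExtendable G fun z => f z + g z := by
  obtain ⟨hfd, ⟨M, hM⟩, e, he, hef⟩ := hf
  obtain ⟨hgd, ⟨M', hM'⟩, e', he', heg⟩ := hg
  exact ⟨hfd.add hgd, ⟨M + M', fun z hz => norm_add_le_of_le (hM z hz) (hM' z hz)⟩,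
    fun z => e z + e' z, he.add he', fun z hz => congrArg₂ (· + ·) (hef hz) (heg hz)⟩

theorem mul (hf : IsBoundedExtendable G f) (hg : IsBoundedExtendable G g) :
    IsBoundedExtendable G fun z => f z * g z := by
  obtain ⟨hfd, ⟨M, hM⟩, e, he, hef⟩ := hf
  obtain ⟨hgd, ⟨M', hM'⟩, e', he', heg⟩ := hg
  exact ⟨hfd.mul hgd, ⟨M * M', fun z hz => norm_mul_le_of_le (hM z hz) (hM' z hz)⟩,
    fun z => e z * e' z, he.mul he', fun z hz => congrArg₂ (· * ·) (hef hz) (heg hz)⟩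

theorem inv (hf : IsBoundedExtendable G f) {δ : ℝ} (hδ : 0 < δ) (h : ∀ z ∈ G, δ ≤ ‖f z‖) :
    IsBoundedExtendable G fun z => (f z)⁻¹ := by
  obtain ⟨hfd, -, e, he, hef⟩ := hf
  have he0 : ∀ z ∈ closure G, δ ≤ ‖e z‖ := fun z hz =>
    ContinuousWithinAt.closure_le hz continuousWithinAt_const
      ((he z hz).norm.mono subset_closure) fun w hw => (hef hw).symm ▸ h w hw
  exact ⟨hfd.inv fun z hz => norm_pos_iff.1 (hδ.trans_le (h z hz)),
    ⟨δ⁻¹, fun z hz => (norm_inv (f z)).trans_le (inv_anti₀ hδ (h z hz))⟩, fun z => (e z)⁻¹,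
    he.inv₀ fun z hz => norm_pos_iff.1 (hδ.trans_le (he0 z hz)),
    fun z hz => congrArg (·⁻¹) (hef hz)⟩

theorem comp_coordProj {m : ℕ} {s : Fin m → Fin n} (hs : Function.Injective s)
    {D : Set (Fin m → ℂ)} {f : (Fin m → ℂ) → ℂ} (hf : IsBoundedExtendable D f) :
    IsBoundedExtendable (coordProj s ⁻¹' D) fun z => f (coordProj s z) := by
  obtain ⟨hfd, ⟨M, hM⟩, e, he, hef⟩ := hf
  refine ⟨hfd.comp (coordProj s).differentiable.differentiableOn fun z hz => hz,
    ⟨M, fun z hz => hM _ hz⟩, fun z => e (coordProj s z), ?_, fun z hz => hef hz⟩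
  rw [← (isOpenMap_coordProj hs).preimage_closure_eq_closure_preimage (coordProj s).continuous]
  exact he.comp (coordProj s).continuous.continuousOn fun z hz => hz

end IsBoundedExtendable

namespace IsBoundedExtendableUpTo

variable {n : ℕ} {G : Set (Fin n → ℂ)}

theorem isBoundedExtendable {f : (Fin n → ℂ) → ℂ} :
    ∀ {k : ℕ}, IsBoundedExtendableUpTo G k f → IsBoundedExtendable G f
  | 0, h => h
  | _ + 1, h => h.1

theorem of_succ : ∀ {k : ℕ} {f : (Fin n → ℂ) → ℂ},
    IsBoundedExtendableUpTo G (k + 1) f → IsBoundedExtendableUpTo G k f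
  | 0, _, h => h.1
  | _ + 1, _, h => ⟨h.1, fun j => of_succ (h.2 j)⟩

theorem congr (hG : IsOpen G) : ∀ {k : ℕ} {f g : (Fin n → ℂ) → ℂ},
    IsBoundedExtendableUpTo G k f → EqOn g f G → IsBoundedExtendableUpTo G k g
  | 0, _, _, hf, h => IsBoundedExtendable.congr hf h
  | _ + 1, _, _, hf, h => ⟨hf.1.congr h, fun j => congr hG (hf.2 j) (cpartial_eqOn hG h j)⟩

theorem const (G : Set (Fin n → ℂ)) : ∀ (k : ℕ) (c : ℂ), IsBoundedExtendableUpTo G k fun _ => c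
  | 0, c => IsBoundedExtendable.const G c
  | k + 1, c => ⟨IsBoundedExtendable.const G c, fun j => by
      rw [cpartial_const]
      exact const G k 0⟩

theorem add (hG : IsOpen G) : ∀ {k : ℕ} {f g : (Fin n → ℂ) → ℂ}, IsBoundedExtendableUpTo G k f →
    IsBoundedExtendableUpTo G k g → IsBoundedExtendableUpTo G k fun z => f z + g z
  | 0, _, _, hf, hg => IsBoundedExtendable.add hf hg
  | _ + 1, _, _, hf, hg => ⟨hf.1.add hg.1, fun j =>
      congr hG (add hG (hf.2 j) (hg.2 j)) fun _ hz =>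
        cpartial_add (hf.1.differentiableAt hG hz) (hg.1.differentiableAt hG hz) j⟩

theorem mul (hG : IsOpen G) : ∀ {k : ℕ} {f g : (Fin n → ℂ) → ℂ}, IsBoundedExtendableUpTo G k f →
    IsBoundedExtendableUpTo G k g → IsBoundedExtendableUpTo G k fun z => f z * g z
  | 0, _, _, hf, hg => IsBoundedExtendable.mul hf hg
  | _ + 1, _, _, hf, hg => ⟨hf.1.mul hg.1, fun j =>
      congr hG (add hG (mul hG hf.of_succ (hg.2 j)) (mul hG hg.of_succ (hf.2 j))) fun _ hz =>
        cpartial_mul (hf.1.differentiableAt hG hz) (hg.1.differentiableAt hG hz) j⟩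

theorem sum (hG : IsOpen G) {k : ℕ} {ι : Type*} (t : Finset ι) {F : ι → (Fin n → ℂ) → ℂ}
    (hF : ∀ i, IsBoundedExtendableUpTo G k (F i)) :
    IsBoundedExtendableUpTo G k fun z => ∑ i ∈ t, F i z := by
  classical
  induction t using Finset.induction_on with
  | empty => simpa only [Finset.sum_empty] using const G k 0
  | insert i t hi ih => simpa only [Finset.sum_insert hi] using add hG (hF i) ih

theorem inv (hG : IsOpen G) {δ : ℝ} (hδ : 0 < δ) : ∀ {k : ℕ} {f : (Fin n → ℂ) → ℂ},
    IsBoundedExtendableUpTo G k f → (∀ z ∈ G, δ ≤ ‖f z‖) →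
      IsBoundedExtendableUpTo G k fun z => (f z)⁻¹
  | 0, _, hf, h => IsBoundedExtendable.inv hf hδ h
  | k + 1, _, hf, h => ⟨hf.1.inv hδ h, fun j =>
      have hinv := inv hG hδ hf.of_succ h
      congr hG (mul hG (const G k (-1)) (mul hG (mul hG hinv hinv) (hf.2 j))) fun z hz =>
        cpartial_inv (hf.1.differentiableAt hG hz) (norm_pos_iff.1 (hδ.trans_le (h z hz))) j⟩

theorem comp_coordProj {m : ℕ} {s : Fin m → Fin n} (hs : Function.Injective s)
    {D : Set (Fin m → ℂ)} (hD : IsOpen D) : ∀ {k : ℕ} {f : (Fin m → ℂ) → ℂ},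
    IsBoundedExtendableUpTo D k f →
      IsBoundedExtendableUpTo (coordProj s ⁻¹' D) k fun z => f (coordProj s z)
  | 0, _, hf => IsBoundedExtendable.comp_coordProj hs hf
  | k + 1, _, hf => ⟨hf.1.comp_coordProj hs, fun j =>
      have hG : IsOpen (coordProj s ⁻¹' D) := hD.preimage (coordProj s).continuous
      congr hG (sum hG Finset.univ fun i =>
        mul hG (const _ k (coordProj s (Pi.single j 1) i)) (comp_coordProj hs hD (hf.2 i)))
        fun _ hz => cpartial_comp_coordProj (hf.1.differentiableAt hD hz) j⟩

theorem iterate_cpartial (j : Fin n) {k : ℕ} : ∀ {r : ℕ} {f : (Fin n → ℂ) → ℂ},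
    IsBoundedExtendableUpTo G (k + r) f → IsBoundedExtendableUpTo G k ((cpartial j)^[r] f)
  | 0, _, hf => hf
  | r + 1, _, hf => iterate_cpartial (r := r) j (hf.2 j)

theorem isBoundedExtendable_multiPartial {f : (Fin n → ℂ) → ℂ} {ν : Fin n → ℕ} {k : ℕ}
    (hf : IsBoundedExtendableUpTo G k f) (hν : ∑ j, ν j ≤ k) :
    IsBoundedExtendable G (multiPartial ν f) := by
  have hfold : ∀ (L : List (Fin n)) (l : ℕ), IsBoundedExtendableUpTo G (l + (L.map ν).sum) f →
      IsBoundedExtendableUpTo G l (L.foldr (fun j g => (cpartial j)^[ν j] g) f) := by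
    intro L
    induction L with
    | nil => exact fun l hl => hl
    | cons a L ih =>
      intro l hl
      rw [List.map_cons, List.sum_cons, ← add_assoc] at hl
      exact iterate_cpartial a (ih _ hl)
  have hsum : ((List.finRange n).map ν).sum = ∑ j, ν j := by
    rw [← List.ofFn_eq_map, List.sum_ofFn]
  refine (hfold _ (k - ∑ j, ν j) ?_).isBoundedExtendable
  rwa [hsum, Nat.sub_add_cancel hν]

theorem mem_hInfty_inter_aSpace {f : (Fin n → ℂ) → ℂ} (hG : IsOpen G) {k : ℕ}
    (hf : IsBoundedExtendableUpTo G k f) : f ∈ hInfty k G ∩ aSpace k G := by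
  refine ⟨⟨hf.isBoundedExtendable.differentiableOn, fun ν hν => ?_⟩,
    hf.isBoundedExtendable.differentiableOn,
    fun ν hν => (hf.isBoundedExtendable_multiPartial hν).exists_extension⟩
  have hbe := hf.isBoundedExtendable_multiPartial hν
  obtain ⟨M, hM⟩ := hbe.exists_bound
  exact memLp_top_of_bound
    (hbe.differentiableOn.continuousOn.aestronglyMeasurable hG.measurableSet) M
    ((ae_restrict_iff' hG.measurableSet).2 (Filter.Eventually.of_forall hM))

end IsBoundedExtendableUpTo

section DecayingMonomial

variable {m : ℕ} {D : Set (Fin m → ℂ)} {β : Fin m → ℤ} {C r : ℝ}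

theorem norm_laurentMonomial_le_of_mem_closure {ι : Type*} [Fintype ι] {D : Set (ι → ℂ)}
    (hD : IsOpen D) {β : ι → ℤ} {g : (ι → ℂ) → ℝ} (hg : Continuous g) (hg0 : ∀ z, 0 ≤ g z)
    (h : ∀ z ∈ D ∩ nonvanishing ι, ‖laurentMonomial β z‖ ≤ g z) {z : ι → ℂ} (hz : z ∈ closure D) :
    ‖laurentMonomial β z‖ ≤ g z := by
  by_cases hβ : ∃ j, z j = 0 ∧ β j ≠ 0
  · obtain ⟨j, hj, hβj⟩ := hβ
    have hzero : laurentMonomial β z = 0 :=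
      Finset.prod_eq_zero (Finset.mem_univ j) (by rw [hj, zero_zpow _ hβj])
    rw [hzero, norm_zero]
    exact hg0 z
  · push Not at hβ
    have hz' : z ∈ closure (D ∩ nonvanishing ι) :=
      closure_minimal (dense_nonvanishing.open_subset_closure_inter hD) isClosed_closure hz
    have hcont : ContinuousAt (laurentMonomial β) z :=
      (differentiableAt_laurentMonomial β fun j hj => (hβ j hj).ge).continuousAt
    exact ContinuousWithinAt.closure_le hz' hcont.norm.continuousWithinAt hg.continuousWithinAt h

theorem DecaysOn.norm_laurentMonomial_le_exp (hβ : DecaysOn β (logSet D) C r) (hc : IsNCircled D)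
    {z : Fin m → ℂ} (hz : z ∈ D ∩ nonvanishing (Fin m)) :
    ‖laurentMonomial β z‖ ≤ Real.exp (C - r * ‖logAbs z‖) := by
  rw [norm_laurentMonomial_eq_exp β hz.2]
  exact Real.exp_le_exp.2 (hβ _ ((hc.logAbs_mem_logSet_iff hz.2).2 hz.1))

theorem DecaysOn.norm_laurentMonomial_le (hβ : DecaysOn β (logSet D) C 0) (hD : IsOpen D)
    (hc : IsNCircled D) {z : Fin m → ℂ} (hz : z ∈ closure D) :
    ‖laurentMonomial β z‖ ≤ Real.exp C :=
  norm_laurentMonomial_le_of_mem_closure hD continuous_const (fun _ => (Real.exp_pos C).le)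
    (fun w hw => by simpa using hβ.norm_laurentMonomial_le_exp hc hw) hz

theorem DecaysOn.norm_laurentMonomial_le_mul_norm (hβ : DecaysOn β (logSet D) C 1) (hD : IsOpen D)
    (hc : IsNCircled D) (j : Fin m) {z : Fin m → ℂ} (hz : z ∈ closure D) :
    ‖laurentMonomial β z‖ ≤ Real.exp C * ‖z j‖ := by
  refine norm_laurentMonomial_le_of_mem_closure (g := fun z => Real.exp C * ‖z j‖) hD (by fun_prop)
    (fun _ => by positivity) (fun w hw => (hβ.norm_laurentMonomial_le_exp hc hw).trans ?_) hz
  rw [← Real.exp_log (norm_pos_iff.2 (hw.2 j)), ← Real.exp_add, Real.exp_le_exp]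
  have hlog : -‖logAbs w‖ ≤ Real.log ‖w j‖ := neg_le_of_abs_le (norm_le_pi_norm (logAbs w) j)
  linarith

theorem DecaysOn.nonneg_of_apply_eq_zero (hβ : DecaysOn β (logSet D) C 0) (hD : IsOpen D)
    (hc : IsNCircled D) {z : Fin m → ℂ} (hz : z ∈ D) {j : Fin m} (hj : z j = 0) : 0 ≤ β j :=
  nonneg_of_norm_laurentMonomial_le hD hz hj fun _ hw =>
    hβ.norm_laurentMonomial_le hD hc (subset_closure hw.1)

open Filter Topology in
theorem DecaysOn.continuousOn_laurentMonomial (hβ : DecaysOn β (logSet D) C 1) (hD : IsOpen D)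
    (hc : IsNCircled D) : ContinuousOn (laurentMonomial β) (closure D) := by
  intro p hp
  by_cases hp0 : p ∈ nonvanishing (Fin m)
  · exact (differentiableAt_laurentMonomial β fun j hj =>
      absurd hj (hp0 j)).continuousAt.continuousWithinAt
  · obtain ⟨j, hj⟩ : ∃ j, p j = 0 := by simpa [nonvanishing] using hp0
    have hbound := fun {z} => hβ.norm_laurentMonomial_le_mul_norm hD hc j (z := z)
    have hpβ : laurentMonomial β p = 0 := norm_le_zero_iff.1 (by simpa [hj] using hbound hp)
    have hlim : Tendsto (fun z : Fin m → ℂ => Real.exp C * ‖z j‖) (𝓝 p) (𝓝 0) := by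
      simpa [hj] using Continuous.tendsto (f := fun z : Fin m → ℂ => Real.exp C * ‖z j‖)
        (by fun_prop) p
    rw [ContinuousWithinAt, hpβ]
    exact squeeze_zero_norm' (eventually_mem_nhdsWithin.mono fun _ => hbound)
      (hlim.mono_left nhdsWithin_le_nhds)

theorem DecaysOn.isBoundedExtendable_laurentMonomial (hβ : DecaysOn β (logSet D) C 1)
    (hD : IsOpen D) (hc : IsNCircled D) : IsBoundedExtendable D (laurentMonomial β) where
  differentiableOn _ hz := (differentiableAt_laurentMonomial β fun _ hj =>
    (hβ.mono zero_le_one).nonneg_of_apply_eq_zero hD hc hz hj).differentiableWithinAt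
  exists_bound := ⟨Real.exp C, fun _ hz =>
    (hβ.mono zero_le_one).norm_laurentMonomial_le hD hc (subset_closure hz)⟩
  exists_extension := ⟨_, hβ.continuousOn_laurentMonomial hD hc, fun _ _ => rfl⟩

theorem DecaysOn.isBoundedExtendableUpTo_laurentMonomial (hD : IsOpen D) (hc : IsNCircled D) :
    ∀ {k : ℕ} {β : Fin m → ℤ}, DecaysOn β (logSet D) C (k + 1) →
      IsBoundedExtendableUpTo D k (laurentMonomial β)
  | 0, _, hβ => isBoundedExtendable_laurentMonomial (by simpa using hβ) hD hc
  | k + 1, β, hβ => by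
    have hβ₁ : DecaysOn β (logSet D) C 1 :=
      hβ.mono (by push_cast; linarith [k.cast_nonneg (α := ℝ)])
    refine ⟨hβ₁.isBoundedExtendable_laurentMonomial hD hc, fun j => ?_⟩
    have hderiv : IsBoundedExtendableUpTo D k (laurentMonomial (β - Pi.single j 1)) :=
      isBoundedExtendableUpTo_laurentMonomial hD hc (DecaysOn.sub_single (by exact_mod_cast hβ) j)
    exact ((IsBoundedExtendableUpTo.const D k (β j : ℂ)).mul hD hderiv).congr hD fun z hz =>
      cpartial_laurentMonomial β j fun i hi =>
        (hβ₁.mono zero_le_one).nonneg_of_apply_eq_zero hD hc hz hi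

end DecayingMonomial

section Separation

variable {m n : ℕ} {D : Set (Fin m → ℂ)}

theorem IsNCircled.logAbs_notMem_closure_logSet (hc : IsNCircled D) {q : Fin m → ℂ}
    (hq0 : q ∈ nonvanishing (Fin m)) (hq : q ∉ closure D) : logAbs q ∉ closure (logSet D) := by
  intro hlog
  let w : (Fin m → ℝ) → Fin m → ℂ := fun x => (fun j => q j / ‖q j‖) * expPoint x
  have hw : Continuous w := continuous_const.mul continuous_expPoint
  have hnorm : ∀ j, ‖q j‖ ≠ 0 := fun j => norm_ne_zero_iff.2 (hq0 j)
  have hwq : w (logAbs q) = q := funext fun j => by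
    change q j / ‖q j‖ * (Real.exp (Real.log ‖q j‖) : ℝ) = q j
    rw [Real.exp_log (norm_pos_iff.2 (hq0 j)), div_mul_cancel₀ _ (by exact_mod_cast hnorm j)]
  refine hq (hwq ▸ hw.continuousWithinAt.mem_closure hlog fun x hx => ?_)
  exact hc.mul_mem (fun j => by simp [hnorm j]) hx

theorem exists_isBoundedExtendableUpTo_inv_laurentMonomial_sub (hD : IsOpen D) (hc : IsNCircled D)
    (hconv : Convex ℝ (logSet D)) (hlin : linealitySpace (logSet D) = ⊥) {q : Fin m → ℂ}
    (hq0 : q ∈ nonvanishing (Fin m)) (hq : q ∉ closure D) (k : ℕ) :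
    ∃ α : Fin m → ℤ, (∀ z ∈ D, laurentMonomial α z ≠ laurentMonomial α q) ∧
      IsBoundedExtendableUpTo D k fun z => (laurentMonomial α q - laurentMonomial α z)⁻¹ := by
  obtain ⟨α, C, hα, hCq⟩ := exists_int_separating (isOpen_logSet hD) hconv hlin
    (hc.logAbs_notMem_closure_logSet hq0 hq) (k + 1)
  have hgap : 0 < ‖laurentMonomial α q‖ - Real.exp C := by
    rw [norm_laurentMonomial_eq_exp α hq0, sub_pos, Real.exp_lt_exp]
    exact hCq
  have hlow : ∀ z ∈ D, ‖laurentMonomial α q‖ - Real.exp C ≤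
      ‖laurentMonomial α q - laurentMonomial α z‖ := fun z hz => by
    have hle := (hα.mono (by positivity)).norm_laurentMonomial_le hD hc (subset_closure hz)
    linarith [norm_sub_norm_le (laurentMonomial α q) (laurentMonomial α z)]
  refine ⟨α, fun z hz heq => ?_, IsBoundedExtendableUpTo.inv hD hgap ?_ hlow⟩
  · have hpos := hgap.trans_le (hlow z hz)
    rw [heq, sub_self, norm_zero] at hpos
    exact lt_irrefl _ hpos
  · exact ((IsBoundedExtendableUpTo.const D k (laurentMonomial α q)).add hD
      ((IsBoundedExtendableUpTo.const D k (-1)).mul hD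
        (DecaysOn.isBoundedExtendableUpTo_laurentMonomial hD hc hα))).congr hD fun z _ => by
          simp only [neg_one_mul, sub_eq_add_neg]

theorem not_eventuallyEq_inv_sub {E : Type*} [NormedAddCommGroup E] [NormedSpace ℂ E]
    {U : Set E} (hU : IsOpen U) (hUc : IsPreconnected U) {φ g : E → ℂ}
    (hφ : DifferentiableOn ℂ φ U) (hg : DifferentiableOn ℂ g U) {q z : E} (hq : q ∈ U)
    (hz : z ∈ U) (hne : φ z ≠ φ q) : ¬ g =ᶠ[nhds z] fun w => (φ q - φ w)⁻¹ := by
  intro h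
  have hφz : ContinuousAt φ z := (hφ.differentiableAt (hU.mem_nhds hz)).continuousAt
  have hlocal : (fun w => g w * (φ q - φ w)) =ᶠ[nhds z] fun _ => 1 := by
    filter_upwards [h, hφz.eventually_ne hne] with w hw hwne
    rw [hw, inv_mul_cancel₀ (sub_ne_zero.2 hwne.symm)]
  have heq := eqOn_of_isPreconnected_of_eventuallyEq hU hUc
    (hg.mul ((differentiableOn_const (φ q)).sub hφ)) (differentiableOn_const 1) hz hlocal hq
  simp at heq

theorem IsFat.exists_mem_nonvanishing_notMem_closure {G U : Set (Fin n → ℂ)} (hG : IsFat G)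
    (hU : IsOpen U) (hns : ¬ U ⊆ G) : ∃ q ∈ U ∩ nonvanishing (Fin n), q ∉ closure G := by
  have hne : (U ∩ (closure G)ᶜ).Nonempty := by
    by_contra hempty
    rw [not_nonempty_iff_eq_empty, ← disjoint_iff_inter_eq_empty,
      disjoint_compl_right_iff_subset] at hempty
    exact hns (hG ▸ interior_maximal hempty hU)
  obtain ⟨q, ⟨hqU, hqG⟩, hq0⟩ := dense_nonvanishing.inter_open_nonempty _
    (hU.inter isClosed_closure.isOpen_compl) hne
  exact ⟨q, ⟨hqU, hq0⟩, hqG⟩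

theorem isDomainOfHolomorphyFor_coordProj_preimage {s : Fin m → Fin n} (hs : Function.Injective s)
    (hD : IsCDomain D) (hc : IsNCircled D) (hfat : IsFat D) (hconv : Convex ℝ (logSet D))
    (hlin : linealitySpace (logSet D) = ⊥) (k : ℕ) :
    IsDomainOfHolomorphyFor (hInfty k (coordProj s ⁻¹' D) ∩ aSpace k (coordProj s ⁻¹' D))
      (coordProj s ⁻¹' D) := by
  refine ⟨hD.coordProj_preimage hs, ?_⟩
  rintro ⟨G₀, G₁, hG₀, hG₁, hsub, hns, hext⟩
  have hproj : ∀ z ∈ nonvanishing (Fin n), coordProj s z ∈ nonvanishing (Fin m) :=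
    fun z hz i => hz (s i)
  obtain ⟨q, hq, hqG⟩ :=
    ((isFat_coordProj_preimage_iff hs).2 hfat).exists_mem_nonvanishing_notMem_closure hG₁.1 hns
  rw [← (isOpenMap_coordProj hs).preimage_closure_eq_closure_preimage
    (coordProj s).continuous] at hqG
  obtain ⟨α, hne, hα⟩ := exists_isBoundedExtendableUpTo_inv_laurentMonomial_sub hD.1 hc hconv hlin
    (hproj q hq.2) hqG k
  obtain ⟨g, hg, hgf⟩ := hext _ ((hα.comp_coordProj hs hD.1).mem_hInfty_inter_aSpace
    (hD.1.preimage (coordProj s).continuous))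
  obtain ⟨z, hzG₀, hz0⟩ := dense_nonvanishing.inter_open_nonempty _ hG₀.1 hG₀.2.nonempty
  have hmonomial : DifferentiableOn ℂ (fun w => laurentMonomial α (coordProj s w))
      (G₁ ∩ nonvanishing (Fin n)) := fun w hw =>
    ((differentiableAt_laurentMonomial α fun j hj => absurd hj (hproj w hw.2 j)).comp w
      (coordProj s).differentiableAt).differentiableWithinAt
  exact not_eventuallyEq_inv_sub (hG₁.1.inter isOpen_nonvanishing)
    (isPreconnected_inter_nonvanishing hG₁.1 hG₁.2.isPreconnected) hmonomial
    (DifferentiableOn.mono hg inter_subset_left) hq ⟨(hsub hzG₀).2, hz0⟩ (hne _ (hsub hzG₀).1)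
    (Filter.eventuallyEq_of_mem (hG₀.1.mem_nhds hzG₀) hgf)

theorem IsFatPointedTimesAffine.isDomainOfHolomorphyFor {G : Set (Fin n → ℂ)}
    (hG : IsFatPointedTimesAffine G) (k : ℕ) :
    IsDomainOfHolomorphyFor (hInfty k G ∩ aSpace k G) G := by
  obtain ⟨m, hm, σ, D, hfat, hc, hD, hlin, rfl⟩ := hG
  exact isDomainOfHolomorphyFor_coordProj_preimage (σ.injective.comp (Fin.castLE_injective hm))
    hD.1 hc hfat (convex_logSet hc hD) hlin k

end Separation

theorem proposition7_general {n : ℕ} (G : Set (Fin n → ℂ)) (hcirc : IsNCircled G) :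
    List.TFAE [
      IsFatPointedTimesAffine G,
      IsDomainOfHolomorphyFor (hInfty 1 G) G,
      ∀ k : ℕ, IsDomainOfHolomorphyFor (hInfty k G ∩ aSpace k G) G] := by
  tfae_have 1 → 3 := fun hG => hG.isDomainOfHolomorphyFor
  tfae_have 3 → 2 := fun hG => (hG 1).mono inter_subset_left
  tfae_have 2 → 1 := fun hG => hG.isFatPointedTimesAffine hcirc le_rfl
  tfae_finish

theorem proposition7 {n : ℕ} (G : Set (Fin n → ℂ)) (hcirc : IsNCircled G)
    (hG : IsDomainOfHolomorphy G) :
    List.TFAE [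
      IsFatPointedTimesAffine G,
      IsDomainOfHolomorphyFor (hInfty 1 G) G,
      ∀ k : ℕ, IsDomainOfHolomorphyFor (hInfty k G ∩ aSpace k G) G] :=
  proposition7_general G hcirc
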